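/- Let $M$ be a smooth manifold, $E\to M$ a (finite rank, real, smooth) vector bundle, $\mathfrak{D}E$ the bundle of first order covariant differential operators on $E$ (its fibre at $m$ consists of the linear maps $\delta:\Gamma(E)\to E_m$ such that for some $X\in T_mM$ one has $\delta(fu)=f(m)\delta(u)+X(f)u(m)$ for all $f\in C^\infty(M)$, $u\in\Gamma(E)$), and $\mathfrak{J}E$ the first jet bundle of $E$, paired with $\mathfrak{D}E$ by $\langle [u]_m,\delta\rangle_E=\delta(u)$. An $E$-CLWX $2$-algebroid is a tuple $(\mathcal{K},\partial,\rho,S,\diamond,\Omega)$ where $\mathcal{K}=K_{-1}\oplus K_0$ is a graded vector bundle over $M$; $\partial:K_{-1}\to K_0$ is a bundle map; $S:\mathcal{K}\otimes\mathcal{K}\to E$ is a surjective, graded symmetric, nondegenerate $E$-valued pairing of degree $1$ (so it pairs $K_0$ with $K_{-1}$ and vanishes on $K_0\otimes K_0$ and $K_{-1}\otimes K_{-1}$), which induces an embedding $\mathcal{K}\hookrightarrow \mathrm{Hom}(\mathcal{K},E)$; $\rho:K_0\to\mathfrak{D}E$ is a bundle map with $\rho^\star(\mathfrak{J}E)\subset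 K_{-1}$, i.e. $S(\rho^\star(\mu),e^0)=\langle\mu,\rho(e^0)\rangle_E$ for all $\mu\in\Gamma(\mathfrak{J}E)$, $e^0\in\Gamma(K_0)$ with $\rho^\star(\mu)\in\Gamma(K_{-1})$; $\diamond:\Gamma(K_{-i})\times\Gamma(K_{-j})\to\Gamma(K_{-(i+j)})$, $0\le i+j\le 1$, is $\mathbb{R}$-bilinear; $\Omega:\wedge^3K_0\to K_{-1}$ is a bundle map; such that (E1) $(\Gamma(\mathcal{K}),\partial,\diamond,\Omega)$ is a Leibniz $2$-algebra, i.e. for all $w,x,y,z\in\Gamma(K_0)$ and $a,b\in\Gamma(K_{-1})$: $\partial(x\diamond a)=x\diamond\partial a$, $\partial(a\diamond x)=\partial a\diamond x$, $\partial a\diamond b=a\diamond\partial b$; the four identities $$\partial\Omega(x,y,z)=x\diamond(y\diamond z)-(x\diamond y)\diamond z-y\diamond(x\diamond z),$$ $$\Omega(x,y,\partial a)=x\diamond(y\diamond a)-(x\diamond y)\diamond a-y\diamond(x\diamond a),$$ $$\Omega(x,\partial a,y)=x\diamond(a\diamond y)-(x\diamond a)\diamond y-a\diamond(x\diamond y),$$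 $$\Omega(\partial a,x,y)=a\diamond(x\diamond y)-(a\diamond x)\diamond y-x\diamond(a\diamond y);$$ and $$\begin{aligned}&w\diamond\Omega(x,y,z)-x\diamond\Omega(w,y,z)+y\diamond\Omega(w,x,z)+\Omega(w,x,y)\diamond z-\Omega(w\diamond x,y,z)-\Omega(x,w\diamond y,z)\\&\quad-\Omega(x,y,w\diamond z)+\Omega(w,x\diamond y,z)+\Omega(w,y,x\diamond z)-\Omega(w,x,y\diamond z)=0;\end{aligned}$$ (E2) $e\diamond e=\frac12\mathcal{D}S(e,e)$ for all $e\in\Gamma(\mathcal{K})$, where $\mathcal{D}:\Gamma(E)\to\Gamma(K_{-1})$ is defined by $S(\mathcal{D}u,e^0)=\rho(e^0)(u)$ for all $e^0\in\Gamma(K_0)$; (E3) $S(\partial e^1_1,e^1_2)=S(e^1_1,\partial e^1_2)$ for all $e^1_1,e^1_2\in\Gamma(K_{-1})$; (E4) $\rho(e_1)S(e_2,e_3)=S(e_1\diamond e_2,e_3)+S(e_2,e_1\diamond e_3)$ for all $e_1,e_2,e_3\in\Gamma(\mathcal{K})$, where $\rho$ is extended by $0$ to $K_{-1}$ and $\diamond$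 by $0$ to $\Gamma(K_{-1})\times\Gamma(K_{-1})$; (E5) $S(\Omega(e^0_1,e^0_2,e^0_3),e^0_4)=-S(e^0_3,\Omega(e^0_1,e^0_2,e^0_4))$ for all $e^0_i\in\Gamma(K_0)$; (E6) $\rho(e^0_1\diamond e^0_2)=[\rho(e^0_1),\rho(e^0_2)]$ (commutator of operators on $\Gamma(E)$) for all $e^0_1,e^0_2\in\Gamma(K_0)$. A Lie $3$-algebra is a $3$-term $L_\infty$-algebra: a graded vector space $\mathfrak{e}=\mathfrak{e}_{-2}\oplus\mathfrak{e}_{-1}\oplus\mathfrak{e}_0$ with graded skew-symmetric multilinear brackets $\mathfrak{l}_k$ of degree $2-k$ ($1\le k\le 4$; $\mathfrak l_k=0$ for $k\geq 5$) such that for all $k\ge1$ and all homogeneous $X_1,\dots,X_k$ $$\sum_{i+j=k+1}(-1)^{i(j-1)}\sum_{\sigma}\mathrm{sgn}(\sigma)\,\mathrm{Ksgn}(\sigma)\,\mathfrak{l}_j(\mathfrak{l}_i(X_{\sigma(1)},\dots,X_{\sigma(i)}),X_{\sigma(i+1)},\dots,X_{\sigma(k)})=0,$$ where $i,j\ge1$,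 $\sigma$ runs over the $(i,k-i)$-unshuffles, and $\mathrm{Ksgn}(\sigma)$ is the Koszul sign. **Theorem.** Let $(\mathcal{K},\partial,\rho,S,\diamond,\Omega)$ be an $E$-CLWX $2$-algebroid. Write $[\![e_1,e_2]\!]=\frac12(e_1\diamond e_2-e_2\diamond e_1)$ and put $$T(e^0_1,e^0_2,e^1)=\tfrac16\big(S(e^0_1,[\![e^0_2,e^1]\!])+S(e^1,[\![e^0_1,e^0_2]\!])+S(e^0_2,[\![e^1,e^0_1]\!])\big),$$ $$\overline{\Omega}(e^0_1,e^0_2,e^0_3,e^0_4)=S(\Omega(e^0_1,e^0_2,e^0_3),e^0_4).$$ Then there is a Lie $3$-algebra structure $(\mathfrak{l}_1,\mathfrak{l}_2,\mathfrak{l}_3,\mathfrak{l}_4)$ on $\mathfrak{e}=\mathfrak{e}_{-2}\oplus\mathfrak{e}_{-1}\oplus\mathfrak{e}_0$, with $\mathfrak{e}_{-2}=\Gamma(E)$, $\mathfrak{e}_{-1}=\Gamma(K_{-1})$, $\mathfrak{e}_0=\Gamma(K_0)$, given by $$\begin{array}{ll} \mathfrak{l}_1(u)=\mathcal{D}u,\quad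 \mathfrak{l}_1(e^1)=\partial e^1, & \\ \mathfrak{l}_2(e^0_1,e^0_2)=[\![e^0_1,e^0_2]\!],\quad \mathfrak{l}_2(e^0,e^1)=[\![e^0,e^1]\!], & \\ \mathfrak{l}_2(e^0,f)=\frac12S(e^0,\mathcal{D}f),\quad \mathfrak{l}_2(e^1_1,e^1_2)=0, & \\ \mathfrak{l}_3(e^0_1,e^0_2,e^0_3)=\Omega(e^0_1,e^0_2,e^0_3),\quad \mathfrak{l}_3(e^0_1,e^0_2,e^1)=-T(e^0_1,e^0_2,e^1), & \\ \mathfrak{l}_4(e^0_1,e^0_2,e^0_3,e^0_4)=\overline{\Omega}(e^0_1,e^0_2,e^0_3,e^0_4) & \end{array}$$ for all $u,f\in\Gamma(E)$, $e^1,e^1_i\in\Gamma(K_{-1})$, $e^0,e^0_i\in\Gamma(K_0)$; all other components of the brackets are determined by graded skew-symmetry or vanish for degree reasons. -/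

import Mathlib

open Bundle
open scoped Manifold ContDiff

noncomputable section

namespace CLWX

/-! ## Lie 3-algebras as 3-term L-infinity algebras -/

section LieThree

/-- The Koszul sign of a permutation `σ` of homogeneous elements `x₁, …, x_k` of degrees
`d₁, …, d_k`: in the free graded commutative algebra `x₁ ⋯ x_k = ε(σ) x_{σ(1)} ⋯ x_{σ(k)}`.
It is the product of `(-1)^{d_{σ(a)} d_{σ(b)}}` over the inversions `a < b`, `σ(b) < σ(a)`. -/
def koszulSign {k : ℕ} (d : Fin k → ℤ) (σ : Equiv.Perm (Fin k)) : ℤˣ :=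
  ∏ p : Fin k × Fin k with p.1 < p.2 ∧ σ p.2 < σ p.1, Int.negOnePow (d (σ p.1) * d (σ p.2))

/-- `σ` is a `(p, k - p)`-unshuffle: `σ(1) < ⋯ < σ(p)` and `σ(p+1) < ⋯ < σ(k)`. -/
def IsUnshuffle {k : ℕ} (p : ℕ) (σ : Equiv.Perm (Fin k)) : Prop :=
  ∀ a b : Fin k, a < b → (b.val < p ∨ p ≤ a.val) → σ a < σ b

instance {k : ℕ} (p : ℕ) (σ : Equiv.Perm (Fin k)) : Decidable (IsUnshuffle p σ) := by
  unfold IsUnshuffle; infer_instance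

/-- The homogeneous part of degree `d` of the graded vector space `L₂ ⊕ L₁ ⊕ L₀`, in which
`L₂`, `L₁`, `L₀` have degrees `-2`, `-1`, `0`. It is zero for every other `d`. -/
def gradedPart (L₂ L₁ L₀ : Type*) [AddCommGroup L₂] [Module ℝ L₂] [AddCommGroup L₁] [Module ℝ L₁]
    [AddCommGroup L₀] [Module ℝ L₀] (d : ℤ) : Submodule ℝ (L₂ × L₁ × L₀) where
  carrier := {v | (d ≠ -2 → v.1 = 0) ∧ (d ≠ -1 → v.2.1 = 0) ∧ (d ≠ 0 → v.2.2 = 0)}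
  add_mem' := by
    rintro v w ⟨h1, h2, h3⟩ ⟨k1, k2, k3⟩
    exact ⟨fun h => by simp [h1 h, k1 h], fun h => by simp [h2 h, k2 h],
      fun h => by simp [h3 h, k3 h]⟩
  zero_mem' := by simp
  smul_mem' := by
    rintro c v ⟨h1, h2, h3⟩
    exact ⟨fun h => by simp [h1 h], fun h => by simp [h2 h], fun h => by simp [h3 h]⟩

/-- A Lie 3-algebra on the graded vector space `L₂ ⊕ L₁ ⊕ L₀` (degrees `-2`, `-1`, `0`), that is,
a 3-term L-infinity algebra: multilinear brackets `l_k` of degree `2 - k`, graded skew-symmetric,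
such that for all homogeneous `x₁, …, x_k`
`∑_{p+q=k+1} (-1)^{p(q-1)} ∑_σ sgn(σ) ε(σ) l_q(l_p(x_{σ(1)}, …, x_{σ(p)}), x_{σ(p+1)}, …) = 0`,
`σ` running over the `(p, k-p)`-unshuffles, `p ≥ 1`.
For degree reasons `l_0` and all `l_k` with `k ≥ 5` vanish. -/
structure LieThreeAlgebra (L₂ L₁ L₀ : Type*) [AddCommGroup L₂] [Module ℝ L₂]
    [AddCommGroup L₁] [Module ℝ L₁] [AddCommGroup L₀] [Module ℝ L₀] where
  /-- the brackets -/
  l : (k : ℕ) → MultilinearMap ℝ (fun _ : Fin k => L₂ × L₁ × L₀) (L₂ × L₁ × L₀)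
  degree : ∀ (k : ℕ) (d : Fin k → ℤ) (x : Fin k → L₂ × L₁ × L₀),
    (∀ a, x a ∈ gradedPart L₂ L₁ L₀ (d a)) →
      l k x ∈ gradedPart L₂ L₁ L₀ (∑ a, d a + 2 - (k : ℤ))
  skew : ∀ (k : ℕ) (d : Fin k → ℤ) (x : Fin k → L₂ × L₁ × L₀),
    (∀ a, x a ∈ gradedPart L₂ L₁ L₀ (d a)) → ∀ σ : Equiv.Perm (Fin k),
      l k (fun a => x (σ a)) = ((Equiv.Perm.sign σ * koszulSign d σ : ℤˣ) : ℤ) • l k x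
  /- Here `p = i + 1` runs over `1, …, k`, and `q = k - p + 1`. -/
  jacobi : ∀ (k : ℕ) (d : Fin k → ℤ) (x : Fin k → L₂ × L₁ × L₀),
    (∀ a, x a ∈ gradedPart L₂ L₁ L₀ (d a)) →
      ∑ i : Fin k, (-1 : ℤ) ^ ((i.val + 1) * (k - (i.val + 1))) •
        ∑ σ : Equiv.Perm (Fin k) with IsUnshuffle (i.val + 1) σ,
          ((Equiv.Perm.sign σ * koszulSign d σ : ℤˣ) : ℤ) •
            l (k - (i.val + 1) + 1) (Fin.cons
              (l (i.val + 1) (fun a => x (σ ⟨a.val, by omega⟩)))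
              (fun b : Fin (k - (i.val + 1)) => x (σ ⟨i.val + 1 + b.val, by omega⟩))) = 0

variable {L₂ L₁ L₀ : Type*} [AddCommGroup L₂] [AddCommGroup L₁] [AddCommGroup L₀]

/-- Inclusion of the degree `-2` part. -/
def deg2 (u : L₂) : L₂ × L₁ × L₀ := (u, 0, 0)

/-- Inclusion of the degree `-1` part. -/
def deg1 (a : L₁) : L₂ × L₁ × L₀ := (0, a, 0)

/-- Inclusion of the degree `0` part. -/
def deg0 (x : L₀) : L₂ × L₁ × L₀ := (0, 0, x)

end LieThree

/-! ## Leibniz 2-algebras (2-term strongly homotopy Leibniz algebras) -/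

/-- `V₁ --d--> V₀` with products `V₀ × V₀ → V₀`, `V₀ × V₁ → V₁`, `V₁ × V₀ → V₁` and the trilinear
map `l₃ : V₀ × V₀ × V₀ → V₁` is a Leibniz 2-algebra. -/
structure IsLeibnizTwoAlgebra {V₁ V₀ : Type*} [AddCommGroup V₁] [Module ℝ V₁] [AddCommGroup V₀]
    [Module ℝ V₀] (d : V₁ →ₗ[ℝ] V₀) (m₀₀ : V₀ →ₗ[ℝ] V₀ →ₗ[ℝ] V₀) (m₀₁ : V₀ →ₗ[ℝ] V₁ →ₗ[ℝ] V₁)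
    (m₁₀ : V₁ →ₗ[ℝ] V₀ →ₗ[ℝ] V₁) (l₃ : MultilinearMap ℝ (fun _ : Fin 3 => V₀) V₁) : Prop where
  d_right : ∀ x a, d (m₀₁ x a) = m₀₀ x (d a)
  d_left : ∀ a x, d (m₁₀ a x) = m₀₀ (d a) x
  d_mid : ∀ a b, m₀₁ (d a) b = m₁₀ a (d b)
  leibniz₀₀₀ : ∀ x y z,
    d (l₃ ![x, y, z]) = m₀₀ x (m₀₀ y z) - m₀₀ (m₀₀ x y) z - m₀₀ y (m₀₀ x z)
  leibniz₀₀₁ : ∀ x y a,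
    l₃ ![x, y, d a] = m₀₁ x (m₀₁ y a) - m₀₁ (m₀₀ x y) a - m₀₁ y (m₀₁ x a)
  leibniz₀₁₀ : ∀ x a y,
    l₃ ![x, d a, y] = m₀₁ x (m₁₀ a y) - m₁₀ (m₀₁ x a) y - m₁₀ a (m₀₀ x y)
  leibniz₁₀₀ : ∀ a x y,
    l₃ ![d a, x, y] = m₁₀ a (m₀₀ x y) - m₁₀ (m₁₀ a x) y - m₀₁ x (m₁₀ a y)
  jacobiator : ∀ w x y z,
    m₀₁ w (l₃ ![x, y, z]) - m₀₁ x (l₃ ![w, y, z]) + m₀₁ y (l₃ ![w, x, z]) + m₁₀ (l₃ ![w, x, y]) z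
      - l₃ ![m₀₀ w x, y, z] - l₃ ![x, m₀₀ w y, z] - l₃ ![x, y, m₀₀ w z]
      + l₃ ![w, m₀₀ x y, z] + l₃ ![w, y, m₀₀ x z] - l₃ ![w, x, m₀₀ y z] = 0

/-! ## Covariant differential operators on a vector bundle -/

section Bundles

variable {EM : Type*} [NormedAddCommGroup EM] [NormedSpace ℝ EM]
  {H : Type*} [TopologicalSpace H] (I : ModelWithCorners ℝ EM H)
  {M : Type*} [TopologicalSpace M] [ChartedSpace H M]
  (F : Type*) [NormedAddCommGroup F] [NormedSpace ℝ F]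
  (E : M → Type*) [TopologicalSpace (TotalSpace F E)] [∀ m, AddCommGroup (E m)]
  [∀ m, Module ℝ (E m)] [∀ m, TopologicalSpace (E m)] [FiberBundle F E] [VectorBundle ℝ F E]

/-- The space `Γ(E)` of smooth sections of the vector bundle `E`. -/
abbrev Sec := Cₛ^∞⟮I; F, E⟯

variable {I F E} in
/-- The product `f u ∈ Γ(E)` of `f ∈ C^∞(M)` and `u ∈ Γ(E)`. -/
def smulSec (f : C^∞⟮I, M; ℝ⟯) (u : Sec I F E) : Sec I F E :=
  ⟨fun m => f m • u m, f.contMDiff.smul_section u.contMDiff⟩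

variable {I} in
/-- The derivative `X(f)` of `f ∈ C^∞(M)` along `X ∈ T_m M`. -/
def vecDeriv {m : M} (X : TangentSpace I m) (f : C^∞⟮I, M; ℝ⟯) : ℝ := mfderiv I 𝓘(ℝ, ℝ) f m X

/-- The fibre at `m` of the bundle `𝔇E` of first order covariant differential operators on `E`:
the linear maps `δ : Γ(E) → E_m` for which there is a tangent vector `X ∈ T_m M` with
`δ(f u) = f(m) δ(u) + X(f) u(m)` for all `f ∈ C^∞(M)`, `u ∈ Γ(E)`. -/
def covDiffOp (m : M) : Submodule ℝ (Sec I F E →ₗ[ℝ] E m) where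
  carrier := {δ | ∃ X : TangentSpace I m, ∀ (f : C^∞⟮I, M; ℝ⟯) (u : Sec I F E),
    δ (smulSec f u) = f m • δ u + vecDeriv X f • u m}
  add_mem' := by
    rintro δ δ' ⟨X, hX⟩ ⟨X', hX'⟩
    refine ⟨X + X', fun f u => ?_⟩
    have h : vecDeriv (X + X') f = vecDeriv X f + vecDeriv X' f :=
      map_add (mfderiv I 𝓘(ℝ, ℝ) f m) X X'
    rw [LinearMap.add_apply, LinearMap.add_apply, hX, hX', h, add_smul, smul_add]
    abel
  zero_mem' := by
    refine ⟨0, fun f u => ?_⟩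
    have h : vecDeriv (0 : TangentSpace I m) f = 0 := map_zero (mfderiv I 𝓘(ℝ, ℝ) f m)
    rw [h]
    simp
  smul_mem' := by
    rintro c δ ⟨X, hX⟩
    refine ⟨c • X, fun f u => ?_⟩
    have h : vecDeriv (c • X) f = c * vecDeriv X f := map_smul (mfderiv I 𝓘(ℝ, ℝ) f m) c X
    rw [LinearMap.smul_apply, LinearMap.smul_apply, hX, h, smul_add, mul_smul, smul_comm]

end Bundles

/-! ## `E`-CLWX 2-algebroids -/

section Algebroids

variable {EM : Type*} [NormedAddCommGroup EM] [NormedSpace ℝ EM]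
  {H : Type*} [TopologicalSpace H] (I : ModelWithCorners ℝ EM H)
  {M : Type*} [TopologicalSpace M] [ChartedSpace H M]
  (F : Type*) [NormedAddCommGroup F] [NormedSpace ℝ F]
  (E : M → Type*) [TopologicalSpace (TotalSpace F E)] [∀ m, AddCommGroup (E m)]
  [∀ m, Module ℝ (E m)] [∀ m, TopologicalSpace (E m)] [FiberBundle F E] [VectorBundle ℝ F E]
  (F₁ : Type*) [NormedAddCommGroup F₁] [NormedSpace ℝ F₁]
  (K₁ : M → Type*) [TopologicalSpace (TotalSpace F₁ K₁)] [∀ m, AddCommGroup (K₁ m)]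
  [∀ m, Module ℝ (K₁ m)] [∀ m, TopologicalSpace (K₁ m)] [FiberBundle F₁ K₁] [VectorBundle ℝ F₁ K₁]
  (F₀ : Type*) [NormedAddCommGroup F₀] [NormedSpace ℝ F₀]
  (K₀ : M → Type*) [TopologicalSpace (TotalSpace F₀ K₀)] [∀ m, AddCommGroup (K₀ m)]
  [∀ m, Module ℝ (K₀ m)] [∀ m, TopologicalSpace (K₀ m)] [FiberBundle F₀ K₀] [VectorBundle ℝ F₀ K₀]

/-- The underlying data `(𝒦, ∂, ρ, S, ⋄, Ω)` of an `E`-CLWX 2-algebroid on the graded vector bundle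
`𝒦 = K_{-1} ⊕ K_0` (here `K₁` stands for `K_{-1}`). A bundle map is a family of linear maps between
the fibres that takes smooth sections to smooth sections. -/
structure PreECLWX where
  /-- the bundle map `∂ : K_{-1} → K_0` -/
  bd : ∀ m, K₁ m →ₗ[ℝ] K₀ m
  bd_smooth : ∀ a : Sec I F₁ K₁, CMDiff ∞ (T% fun m => bd m (a m))
  /-- The degree `1` graded symmetric pairing `S : 𝒦 ⊗ 𝒦 → E`. For degree reasons it vanishes on
  `K_0 ⊗ K_0` and on `K_{-1} ⊗ K_{-1}`, so it is given by its component on `K_0 ⊗ K_{-1}`; on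
  `K_{-1} ⊗ K_0` it is `S(e¹, e⁰) = S(e⁰, e¹)`. -/
  pairing : ∀ m, K₀ m →ₗ[ℝ] K₁ m →ₗ[ℝ] E m
  pairing_smooth : ∀ (x : Sec I F₀ K₀) (a : Sec I F₁ K₁),
    CMDiff ∞ (T% fun m => pairing m (x m) (a m))
  /-- `S` is surjective, as a bundle map on the tensor product. -/
  pairing_surj : ∀ m, Submodule.span ℝ {v : E m | ∃ x a, pairing m x a = v} = ⊤
  /-- `S` is nondegenerate: `K_0 → Hom(K_{-1}, E)` is injective … -/
  pairing_nondeg₀ : ∀ m (x : K₀ m), (∀ a, pairing m x a = 0) → x = 0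
  /-- … and `K_{-1} → Hom(K_0, E)` is injective. -/
  pairing_nondeg₁ : ∀ m (a : K₁ m), (∀ x, pairing m x a = 0) → a = 0
  /-- the anchor `ρ : K_0 → 𝔇E`, a bundle map -/
  anchor : ∀ m, K₀ m →ₗ[ℝ] covDiffOp I F E m
  anchor_smooth : ∀ (x : Sec I F₀ K₀) (u : Sec I F E),
    CMDiff ∞ (T% fun m => (anchor m (x m) : Sec I F E →ₗ[ℝ] E m) u)
  /-- `ρ^⋆(𝔍E) ⊂ K_{-1}`: for every `u ∈ Γ(E)` the `Hom(K_0, E)`-valued section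
  `e⁰ ↦ ⟨j¹u, ρ(e⁰)⟩ = ρ(e⁰)(u)` is `S(k, ·)` for a section `k` of `K_{-1}`. The first jets
  of smooth sections `u` at `m` make up the whole fibre of the jet bundle `𝔍E` at `m`. -/
  anchor_star : ∀ u : Sec I F E, ∃ k : Sec I F₁ K₁, ∀ m (x : K₀ m),
    pairing m x (k m) = (anchor m x : Sec I F E →ₗ[ℝ] E m) u
  /-- `⋄ : Γ(K_0) × Γ(K_0) → Γ(K_0)` -/
  dia₀₀ : Sec I F₀ K₀ →ₗ[ℝ] Sec I F₀ K₀ →ₗ[ℝ] Sec I F₀ K₀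
  /-- `⋄ : Γ(K_0) × Γ(K_{-1}) → Γ(K_{-1})` -/
  dia₀₁ : Sec I F₀ K₀ →ₗ[ℝ] Sec I F₁ K₁ →ₗ[ℝ] Sec I F₁ K₁
  /-- `⋄ : Γ(K_{-1}) × Γ(K_0) → Γ(K_{-1})` -/
  dia₁₀ : Sec I F₁ K₁ →ₗ[ℝ] Sec I F₀ K₀ →ₗ[ℝ] Sec I F₁ K₁
  /-- the bundle map `Ω : ⋀³ K_0 → K_{-1}` -/
  form : ∀ m, K₀ m [⋀^Fin 3]→ₗ[ℝ] K₁ m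
  form_smooth : ∀ x : Fin 3 → Sec I F₀ K₀, CMDiff ∞ (T% fun m => form m (fun i => x i m))

namespace PreECLWX

variable {I F E F₁ K₁ F₀ K₀} (A : PreECLWX I F E F₁ K₁ F₀ K₀)

/-- `∂ : Γ(K_{-1}) → Γ(K_0)` -/
def bdSec : Sec I F₁ K₁ →ₗ[ℝ] Sec I F₀ K₀ where
  toFun a := ⟨fun m => A.bd m (a m), A.bd_smooth a⟩
  map_add' a b := by ext m; exact map_add (A.bd m) (a m) (b m)
  map_smul' c a := by ext m; exact map_smul (A.bd m) c (a m)

/-- `S : Γ(K_0) × Γ(K_{-1}) → Γ(E)` -/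
def S : Sec I F₀ K₀ →ₗ[ℝ] Sec I F₁ K₁ →ₗ[ℝ] Sec I F E :=
  LinearMap.mk₂ ℝ (fun x a => ⟨fun m => A.pairing m (x m) (a m), A.pairing_smooth x a⟩)
    (fun x y a => by ext m; exact LinearMap.map_add₂ (A.pairing m) (x m) (y m) (a m))
    (fun c x a => by ext m; exact LinearMap.map_smul₂ (A.pairing m) c (x m) (a m))
    (fun x a b => by ext m; exact map_add (A.pairing m (x m)) (a m) (b m))
    (fun c x a => by ext m; exact map_smul (A.pairing m (x m)) c (a m))

/-- `ρ : Γ(K_0) → Γ(𝔇E)`, a section of `𝔇E` acting as an operator on `Γ(E)` -/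
def rho : Sec I F₀ K₀ →ₗ[ℝ] Sec I F E →ₗ[ℝ] Sec I F E :=
  LinearMap.mk₂ ℝ
    (fun x u => ⟨fun m => (A.anchor m (x m) : Sec I F E →ₗ[ℝ] E m) u, A.anchor_smooth x u⟩)
    (fun x y u => by
      ext m
      change (A.anchor m (x m + y m) : Sec I F E →ₗ[ℝ] E m) u = _
      rw [map_add]; rfl)
    (fun c x u => by
      ext m
      change (A.anchor m (c • x m) : Sec I F E →ₗ[ℝ] E m) u = _
      rw [map_smul]; rfl)
    (fun x u v => by ext m; exact map_add (A.anchor m (x m) : Sec I F E →ₗ[ℝ] E m) u v)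
    (fun c x u => by ext m; exact map_smul (A.anchor m (x m) : Sec I F E →ₗ[ℝ] E m) c u)

/-- `Ω : ⋀³ Γ(K_0) → Γ(K_{-1})` -/
def Omega : Sec I F₀ K₀ [⋀^Fin 3]→ₗ[ℝ] Sec I F₁ K₁ where
  toFun x := ⟨fun m => A.form m (fun i => x i m), A.form_smooth x⟩
  map_update_add' x i y z := by
    ext m
    have h : ∀ w : Sec I F₀ K₀, (fun j => (Function.update x i w) j m)
        = Function.update (fun j => x j m) i (w m) := by
      intro w; funext j
      rcases eq_or_ne j i with rfl | hj
      · simp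
      · simp [hj]
    have key := (A.form m).map_update_add (fun j => x j m) i (y m) (z m)
    rw [← h y, ← h z] at key
    have hyz := h (y + z)
    change A.form m (fun j => _) = A.form m (fun j => _) + A.form m (fun j => _)
    rw [hyz]
    exact key
  map_update_smul' x i c y := by
    ext m
    have h : ∀ w : Sec I F₀ K₀, (fun j => (Function.update x i w) j m)
        = Function.update (fun j => x j m) i (w m) := by
      intro w; funext j
      rcases eq_or_ne j i with rfl | hj
      · simp
      · simp [hj]
    have key := (A.form m).map_update_smul (fun j => x j m) i c (y m)
    rw [← h y] at key
    have hy := h (c • y)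
    change A.form m (fun j => _) = c • A.form m (fun j => _)
    rw [hy]
    exact key
  map_eq_zero_of_eq' x i j hij hne := by
    ext m
    exact (A.form m).map_eq_zero_of_eq _ (by rw [hij]) hne

/-- `𝒟 : Γ(E) → Γ(K_{-1})`, determined by `S(𝒟u, e⁰) = ρ(e⁰)(u)` for all `e⁰`. -/
def D (u : Sec I F E) : Sec I F₁ K₁ := (A.anchor_star u).choose

theorem S_D (x : Sec I F₀ K₀) (u : Sec I F E) : A.S x (A.D u) = A.rho x u := by
  ext m
  exact (A.anchor_star u).choose_spec m (x m)

/-- `⟦e⁰₁, e⁰₂⟧ = ½ (e⁰₁ ⋄ e⁰₂ - e⁰₂ ⋄ e⁰₁)` -/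
def courant₀₀ (x y : Sec I F₀ K₀) : Sec I F₀ K₀ := (1 / 2 : ℝ) • (A.dia₀₀ x y - A.dia₀₀ y x)

/-- `⟦e⁰, e¹⟧ = ½ (e⁰ ⋄ e¹ - e¹ ⋄ e⁰)` -/
def courant₀₁ (x : Sec I F₀ K₀) (a : Sec I F₁ K₁) : Sec I F₁ K₁ :=
  (1 / 2 : ℝ) • (A.dia₀₁ x a - A.dia₁₀ a x)

/-- `⟦e¹, e⁰⟧ = ½ (e¹ ⋄ e⁰ - e⁰ ⋄ e¹)` -/
def courant₁₀ (a : Sec I F₁ K₁) (x : Sec I F₀ K₀) : Sec I F₁ K₁ :=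
  (1 / 2 : ℝ) • (A.dia₁₀ a x - A.dia₀₁ x a)

/-- `T(e⁰₁, e⁰₂, e¹) = ⅙ (S(e⁰₁, ⟦e⁰₂, e¹⟧) + S(e¹, ⟦e⁰₁, e⁰₂⟧) + S(e⁰₂, ⟦e¹, e⁰₁⟧))` -/
def T (x y : Sec I F₀ K₀) (a : Sec I F₁ K₁) : Sec I F E :=
  (1 / 6 : ℝ) • (A.S x (A.courant₀₁ y a) + A.S (A.courant₀₀ x y) a + A.S y (A.courant₁₀ a x))

/-- `Ω̄(e⁰₁, e⁰₂, e⁰₃, e⁰₄) = S(Ω(e⁰₁, e⁰₂, e⁰₃), e⁰₄)` -/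
def OmegaBar (x y z w : Sec I F₀ K₀) : Sec I F E := A.S w (A.Omega ![x, y, z])

end PreECLWX

/-- An `E`-CLWX 2-algebroid. Each axiom is written out on the homogeneous components on which it
is not trivial for degree reasons (`⋄` vanishes on `Γ(K_{-1}) × Γ(K_{-1})`, `S` vanishes on
`K_0 ⊗ K_0` and on `K_{-1} ⊗ K_{-1}`, and `ρ` vanishes on `K_{-1}`). -/
structure ECLWXTwoAlgebroid extends PreECLWX I F E F₁ K₁ F₀ K₀ where
  /-- (E1) -/
  leibniz : IsLeibnizTwoAlgebra toPreECLWX.bdSec dia₀₀ dia₀₁ dia₁₀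
    toPreECLWX.Omega.toMultilinearMap
  /-- (E2) `e ⋄ e = ½ 𝒟 S(e, e)`, for `e ∈ Γ(K_0)` … -/
  dia_self : ∀ x, dia₀₀ x x = 0
  /-- … and its part bilinear in the two components of `e = e⁰ + e¹`. -/
  dia_symm : ∀ x a, dia₀₁ x a + dia₁₀ a x = toPreECLWX.D (toPreECLWX.S x a)
  /-- (E3) `S(∂e¹₁, e¹₂) = S(e¹₁, ∂e¹₂)` -/
  S_bd : ∀ a b, toPreECLWX.S (toPreECLWX.bdSec a) b = toPreECLWX.S (toPreECLWX.bdSec b) a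
  /-- (E4) `ρ(e₁) S(e₂, e₃) = S(e₁ ⋄ e₂, e₃) + S(e₂, e₁ ⋄ e₃)`, for `e₁ ∈ Γ(K_0)` … -/
  rho_S : ∀ x y a, toPreECLWX.rho x (toPreECLWX.S y a) =
    toPreECLWX.S (dia₀₀ x y) a + toPreECLWX.S y (dia₀₁ x a)
  /-- … and for `e₁ ∈ Γ(K_{-1})`. -/
  S_dia₁₀ : ∀ a x y, 0 = toPreECLWX.S y (dia₁₀ a x) + toPreECLWX.S x (dia₁₀ a y)
  /-- (E5) `S(Ω(e⁰₁, e⁰₂, e⁰₃), e⁰₄) = - S(e⁰₃, Ω(e⁰₁, e⁰₂, e⁰₄))` -/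
  S_Omega : ∀ x y z w, toPreECLWX.S w (toPreECLWX.Omega ![x, y, z]) =
    - toPreECLWX.S z (toPreECLWX.Omega ![x, y, w])
  /-- (E6) `ρ(e⁰₁ ⋄ e⁰₂) = [ρ(e⁰₁), ρ(e⁰₂)]` -/
  rho_dia : ∀ x y u, toPreECLWX.rho (dia₀₀ x y) u =
    toPreECLWX.rho x (toPreECLWX.rho y u) - toPreECLWX.rho y (toPreECLWX.rho x u)

end Algebroids

end CLWX

end

open CLWX

/-! By (E2), `⋄` is already skew on Γ(K₀), and in mixed degree x ⋄ a = ⟦x, a⟧ + ½ 𝒟S(x, a).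
Replacing `⋄` by the skew bracket therefore costs only 𝒟-exact terms, and these are what the extra
summand Γ(E) with 𝔩₁ = 𝒟 absorbs. In the Leibniz identity for Ω(x, y, ∂a) the corrections add up to
𝒟T(x, y, a); in the ten-term identity for Ω, (E5) collapses them to -𝒟Ω̄. These are the Jacobi
identities on (x, y, a) and on four elements of degree 0.

The identities with values in Γ(E) follow by pairing with S: (E4) and (E6) rewrite S(y, ⟦x, a⟧) and
ρ(⟦x, y⟧), which gives `SkewCLWX.jacobi_T`, `SkewCLWX.T_d_symm` and the closedness of Ω̄,
`SkewCLWX.S_Om_closed`.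

Geometry enters through ρ∘∂ = 0 and ∂∘𝒟 = 0, and through the nondegeneracy of S on sections. The
axioms give ρ(∂a) = 0 only on values of S; since these span E, a covariant differential operator
killing them has zero symbol and vanishes. The rest is linear algebra over ℝ, isolated in
`SkewCLWX`.

Each bracket vanishes as soon as two arguments have nonzero degree, so the brackets are ordinary
alternating maps on the total space and graded skew-symmetry is automatic. The k-th Jacobi
expression has degree 3 - k plus the degrees of its entries, which leaves only k ≤ 5 and a few
degree patterns. -/

noncomputable section

namespace CLWX

/-! ### Global smooth sections and tensoriality -/

section Geometry

variable {EM : Type*} [NormedAddCommGroup EM] [NormedSpace ℝ EM]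
  {H : Type*} [TopologicalSpace H] {I : ModelWithCorners ℝ EM H}
  {M : Type*} [TopologicalSpace M] [ChartedSpace H M]
  {F : Type*} [NormedAddCommGroup F] [NormedSpace ℝ F]
  {E : M → Type*} [TopologicalSpace (TotalSpace F E)] [∀ m, AddCommGroup (E m)]
  [∀ m, Module ℝ (E m)] [∀ m, TopologicalSpace (E m)] [FiberBundle F E] [VectorBundle ℝ F E]

/-- A smooth section over an open set, multiplied by a smooth function supported in that set. -/
def cutoffSec {χ : M → ℝ} {U : Set M} {s : ∀ m, E m} (hχ : ContMDiff I 𝓘(ℝ, ℝ) ∞ χ)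
    (hU : IsOpen U) (hχU : tsupport χ ⊆ U) (hs : CMDiff[U] ∞ (T% s)) : Sec I F E :=
  ⟨χ • s, ContMDiffOn.smul_section_of_tsupport hχ.contMDiffOn hU hχU hs⟩

@[simp]
theorem cutoffSec_apply {χ : M → ℝ} {U : Set M} {s : ∀ m, E m} (hχ : ContMDiff I 𝓘(ℝ, ℝ) ∞ χ)
    (hU : IsOpen U) (hχU : tsupport χ ⊆ U) (hs : CMDiff[U] ∞ (T% s)) (m : M) :
    cutoffSec hχ hU hχU hs m = χ m • s m := rfl

/-- A smooth function on an open set, multiplied by a smooth function supported in that set. -/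
def cutoffFun {χ : M → ℝ} {U : Set M} {f : M → ℝ} (hχ : ContMDiff I 𝓘(ℝ, ℝ) ∞ χ)
    (hU : IsOpen U) (hχU : tsupport χ ⊆ U) (hf : CMDiff[U] ∞ f) : C^∞⟮I, M; ℝ⟯ :=
  ⟨fun m => χ m * f m, contMDiff_of_tsupport fun _ hm =>
    hχ.contMDiffAt.mul (hf.contMDiffAt (hU.mem_nhds (hχU (tsupport_mul_subset_left hm))))⟩

@[simp]
theorem cutoffFun_apply {χ : M → ℝ} {U : Set M} {f : M → ℝ} (hχ : ContMDiff I 𝓘(ℝ, ℝ) ∞ χ)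
    (hU : IsOpen U) (hχU : tsupport χ ⊆ U) (hf : CMDiff[U] ∞ f) (m : M) :
    cutoffFun hχ hU hχU hf m = χ m * f m := rfl

@[simp]
theorem smulSec_apply (f : C^∞⟮I, M; ℝ⟯) (u : Sec I F E) (m : M) :
    smulSec f u m = f m • u m := rfl

theorem sum_sec_apply {ι : Type*} (t : Finset ι) (u : ι → Sec I F E) (m : M) :
    (∑ i ∈ t, u i) m = ∑ i ∈ t, u i m :=
  (congrFun (map_sum (ContMDiffSection.coeAddHom I F ∞ E) u t) m).trans (Finset.sum_apply m t _)

section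

variable [FiniteDimensional ℝ EM] [IsManifold I ∞ M] [T2Space M]

theorem exists_bump (I : ModelWithCorners ℝ EM H) [IsManifold I ∞ M] {m : M} {U : Set M}
    (hU : IsOpen U) (hm : m ∈ U) :
    ∃ χ : M → ℝ, ContMDiff I 𝓘(ℝ, ℝ) ∞ χ ∧ tsupport χ ⊆ U ∧ χ m = 1 := by
  obtain ⟨χ, -, h⟩ := (SmoothBumpFunction.nhds_basis_tsupport (I := I) m).mem_iff.1 (hU.mem_nhds hm)
  exact ⟨χ, χ.contMDiff, h, χ.eq_one⟩

variable [FiniteDimensional ℝ F] [ContMDiffVectorBundle ∞ F E I]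

variable (I F) in
/-- Every vector in a fibre is the value of a global smooth section. -/
theorem exists_sec_apply_eq {m : M} (v : E m) : ∃ s : Sec I F E, s m = v := by
  classical
  have : ContMDiffVectorBundle 1 F E I := ContMDiffVectorBundle.of_le (n := ∞) (by simp)
  let e := trivializationAt F E m
  have hm : m ∈ e.baseSet := FiberBundle.mem_baseSet_trivializationAt F E m
  let b := Module.Basis.ofVectorSpace ℝ F
  obtain ⟨χ, hχ, hsupp, h1⟩ := exists_bump I e.open_baseSet hm
  refine ⟨∑ i, e.localFrameCoeff I b i m v • cutoffSec hχ e.open_baseSet hsupp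
    (e.contMDiffOn_localFrame_baseSet ∞ b i), ?_⟩
  -- The frame expansion is a pointwise statement, so it may be applied to the discontinuous section
  -- equal to v at m and 0 elsewhere.
  have h := e.eq_sum_localFrameCoeff_smul (I := I) (b := b) (s := Function.update 0 m v) hm
  simp only [Function.update_self] at h
  rw [sum_sec_apply]
  simp only [ContMDiffSection.coe_smul, Pi.smul_apply, cutoffSec_apply, h1, one_smul]
  exact h.symm

/-- A `C^∞(M)`-linear map from sections to a fibre depends only on the value of the section. -/
theorem apply_eq_zero_of_tensorial {m : M} {V : Type*} [AddCommGroup V] [Module ℝ V]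
    (δ : Sec I F E →ₗ[ℝ] V)
    (hδ : ∀ (f : C^∞⟮I, M; ℝ⟯) (u : Sec I F E), δ (smulSec f u) = f m • δ u)
    {u : Sec I F E} (hu : u m = 0) : δ u = 0 := by
  have : ContMDiffVectorBundle 1 F E I := ContMDiffVectorBundle.of_le (n := ∞) (by simp)
  let e := trivializationAt F E m
  have hm : m ∈ e.baseSet := FiberBundle.mem_baseSet_trivializationAt F E m
  let b := Module.Basis.ofVectorSpace ℝ F
  obtain ⟨χ, hχ, hsupp, h1⟩ := exists_bump I e.open_baseSet hm
  let X : C^∞⟮I, M; ℝ⟯ := ⟨χ, hχ⟩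
  let c := fun i => cutoffFun hχ e.open_baseSet hsupp
    (contMDiffOn_baseSet_localFrameCoeff (e := e) b (u.contMDiff.contMDiffOn) i)
  -- Two factors of χ are needed: one globalises the frame coefficients, the other the frame
  -- sections. At m both equal 1.
  have key : smulSec X (smulSec X u) = ∑ i, smulSec (c i) (cutoffSec hχ e.open_baseSet hsupp
      (e.contMDiffOn_localFrame_baseSet ∞ b i)) := by
    ext p
    rw [sum_sec_apply]
    simp only [smulSec_apply, cutoffSec_apply, c, cutoffFun_apply]
    change χ p • χ p • u p = _
    by_cases hp : p ∈ e.baseSet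
    · have h := e.eq_sum_localFrameCoeff_smul (I := I) (b := b) (s := u) hp
      conv_lhs => rw [h]
      simp only [Finset.smul_sum]
      refine Finset.sum_congr rfl fun i _ => ?_
      simp only [smul_smul, LinearMap.piApply_apply]
      congr 1
      ring
    · have : χ p = 0 := image_eq_zero_of_notMem_tsupport fun h => hp (hsupp h)
      simp [this]
  have h2 : δ (smulSec X (smulSec X u)) = δ u := by
    rw [hδ, hδ]
    change χ m • χ m • δ u = δ u
    simp [h1]
  rw [← h2, key, map_sum]
  refine Finset.sum_eq_zero fun i _ => ?_
  rw [hδ]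
  simp [c, hu]

end

end Geometry

/-! ### Nondegeneracy of S on sections, ρ∘∂ = 0 and ∂∘𝒟 = 0 -/

section AlgebroidLemmas

variable {EM : Type*} [NormedAddCommGroup EM] [NormedSpace ℝ EM]
  {H : Type*} [TopologicalSpace H] {I : ModelWithCorners ℝ EM H}
  {M : Type*} [TopologicalSpace M] [ChartedSpace H M]
  {F : Type*} [NormedAddCommGroup F] [NormedSpace ℝ F]
  {E : M → Type*} [TopologicalSpace (TotalSpace F E)] [∀ m, AddCommGroup (E m)]
  [∀ m, Module ℝ (E m)] [∀ m, TopologicalSpace (E m)] [FiberBundle F E] [VectorBundle ℝ F E]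
  {F₁ : Type*} [NormedAddCommGroup F₁] [NormedSpace ℝ F₁]
  {K₁ : M → Type*} [TopologicalSpace (TotalSpace F₁ K₁)] [∀ m, AddCommGroup (K₁ m)]
  [∀ m, Module ℝ (K₁ m)] [∀ m, TopologicalSpace (K₁ m)] [FiberBundle F₁ K₁] [VectorBundle ℝ F₁ K₁]
  {F₀ : Type*} [NormedAddCommGroup F₀] [NormedSpace ℝ F₀]
  {K₀ : M → Type*} [TopologicalSpace (TotalSpace F₀ K₀)] [∀ m, AddCommGroup (K₀ m)]
  [∀ m, Module ℝ (K₀ m)] [∀ m, TopologicalSpace (K₀ m)] [FiberBundle F₀ K₀] [VectorBundle ℝ F₀ K₀]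

namespace PreECLWX

variable (A : PreECLWX I F E F₁ K₁ F₀ K₀)

theorem pairing_D (u : Sec I F E) (m : M) (x : K₀ m) :
    A.pairing m x (A.D u m) = (A.anchor m x : Sec I F E →ₗ[ℝ] E m) u :=
  (A.anchor_star u).choose_spec m x

/-- `𝒟` as a linear map. -/
def DLin : Sec I F E →ₗ[ℝ] Sec I F₁ K₁ where
  toFun := A.D
  map_add' u v := by
    ext m
    refine sub_eq_zero.1 (A.pairing_nondeg₁ m _ fun x => ?_)
    change A.pairing m x (A.D (u + v) m - (A.D u m + A.D v m)) = 0
    simp [pairing_D]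
  map_smul' c u := by
    ext m
    refine sub_eq_zero.1 (A.pairing_nondeg₁ m _ fun x => ?_)
    change A.pairing m x (A.D (c • u) m - c • A.D u m) = 0
    simp [pairing_D]

@[simp]
theorem DLin_apply (u : Sec I F E) : A.DLin u = A.D u := rfl

theorem S_smulSec (f : C^∞⟮I, M; ℝ⟯) (x : Sec I F₀ K₀) (a : Sec I F₁ K₁) :
    A.S (smulSec f x) a = smulSec f (A.S x a) := by
  ext m
  exact LinearMap.map_smul₂ (A.pairing m) (f m) (x m) (a m)

variable [FiniteDimensional ℝ EM] [IsManifold I ∞ M] [T2Space M]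

/-- Fibrewise nondegeneracy passes to sections because every vector of K₀ extends to a global
section. -/
theorem eq_of_S_left [FiniteDimensional ℝ F₀] [ContMDiffVectorBundle ∞ F₀ K₀ I]
    {a b : Sec I F₁ K₁} (h : ∀ x, A.S x a = A.S x b) : a = b := by
  ext m
  refine sub_eq_zero.1 (A.pairing_nondeg₁ m _ fun v => ?_)
  obtain ⟨x, rfl⟩ := exists_sec_apply_eq I F₀ v
  rw [map_sub, sub_eq_zero]
  exact congrArg (fun s : Sec I F E => s m) (h x)

theorem eq_of_S_right [FiniteDimensional ℝ F₁] [ContMDiffVectorBundle ∞ F₁ K₁ I]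
    {x y : Sec I F₀ K₀} (h : ∀ a, A.S x a = A.S y a) : x = y := by
  ext m
  refine sub_eq_zero.1 (A.pairing_nondeg₀ m _ fun v => ?_)
  obtain ⟨a, rfl⟩ := exists_sec_apply_eq I F₁ v
  rw [map_sub, LinearMap.sub_apply, sub_eq_zero]
  exact congrArg (fun s : Sec I F E => s m) (h a)

variable [FiniteDimensional ℝ F] [ContMDiffVectorBundle ∞ F E I]
  [FiniteDimensional ℝ F₁] [ContMDiffVectorBundle ∞ F₁ K₁ I]
  [FiniteDimensional ℝ F₀] [ContMDiffVectorBundle ∞ F₀ K₀ I]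

/-- A covariant differential operator that kills all `S(x, a)` is zero, as its symbol vanishes and
the `S(x, a)` span the fibres of `E`. -/
theorem covDiffOp_eq_zero {m : M} {δ : Sec I F E →ₗ[ℝ] E m} (hδ : δ ∈ covDiffOp I F E m)
    (h : ∀ x a, δ (A.S x a) = 0) : δ = 0 := by
  obtain ⟨X, hX⟩ := hδ
  -- Every vector of E_m is the value of a section killed by δ, because the values of S span E_m.
  have hspan : ∀ v : E m, ∃ u : Sec I F E, u m = v ∧ δ u = 0 := by
    intro v
    have hv : v ∈ Submodule.span ℝ {v : E m | ∃ x a, A.pairing m x a = v} := by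
      rw [A.pairing_surj m]; trivial
    induction hv using Submodule.span_induction with
    | mem v hv =>
      obtain ⟨x, a, rfl⟩ := hv
      obtain ⟨x, rfl⟩ := exists_sec_apply_eq I F₀ x
      obtain ⟨a, rfl⟩ := exists_sec_apply_eq I F₁ a
      exact ⟨A.S x a, rfl, h x a⟩
    | zero => exact ⟨0, rfl, map_zero δ⟩
    | add v w _ _ hv hw =>
      obtain ⟨u, rfl, hu⟩ := hv
      obtain ⟨u', rfl, hu'⟩ := hw
      exact ⟨u + u', rfl, by rw [map_add, hu, hu', add_zero]⟩
    | smul c v _ hv =>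
      obtain ⟨u, rfl, hu⟩ := hv
      exact ⟨c • u, rfl, by rw [map_smul, hu, smul_zero]⟩
  -- Comparing δ on S(fx, a) = f S(x, a) with the Leibniz rule leaves X(f) S(x, a) = 0.
  have hsymbol : ∀ (f : C^∞⟮I, M; ℝ⟯) (v : E m), vecDeriv X f • v = 0 := by
    intro f v
    have hv : v ∈ Submodule.span ℝ {v : E m | ∃ x a, A.pairing m x a = v} := by
      rw [A.pairing_surj m]; trivial
    induction hv using Submodule.span_induction with
    | mem v hv =>
      obtain ⟨x, a, rfl⟩ := hv
      obtain ⟨x, rfl⟩ := exists_sec_apply_eq I F₀ x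
      obtain ⟨a, rfl⟩ := exists_sec_apply_eq I F₁ a
      have := hX f (A.S x a)
      rw [← A.S_smulSec, h, h, smul_zero, zero_add] at this
      exact this.symm
    | zero => exact smul_zero _
    | add v w _ _ hv hw => rw [smul_add, hv, hw, add_zero]
    | smul c v _ hv => rw [smul_comm, hv, smul_zero]
  -- With zero symbol δ is tensorial, so u may be replaced by a killed section with the same value
  -- at m.
  ext u
  obtain ⟨u', hu', h0⟩ := hspan (u m)
  have := apply_eq_zero_of_tensorial δ (fun f u => by rw [hX, hsymbol, add_zero]) (u := u - u')
    (show u m - u' m = 0 by rw [hu', sub_self])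
  rw [map_sub, h0, sub_zero] at this
  exact this

end PreECLWX

namespace ECLWXTwoAlgebroid

variable (A : ECLWXTwoAlgebroid I F E F₁ K₁ F₀ K₀)

theorem dia_skew (x y : Sec I F₀ K₀) : A.dia₀₀ y x = -A.dia₀₀ x y := by
  have h := A.dia_self (x + y)
  simp only [map_add, LinearMap.add_apply, A.dia_self, zero_add, add_zero] at h
  exact eq_neg_of_add_eq_zero_right ((add_comm _ _).trans h)

/-- 𝒟S(x, a) is the symmetric part x ⋄ a + a ⋄ x, which ∂ sends to x ⋄ ∂a + ∂a ⋄ x, and `⋄` is skew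
on Γ(K₀). -/
theorem bd_D_S (x : Sec I F₀ K₀) (a : Sec I F₁ K₁) : A.bdSec (A.D (A.S x a)) = 0 := by
  rw [← A.dia_symm, map_add, A.leibniz.d_right, A.leibniz.d_left, A.dia_skew, neg_add_cancel]

/-- Pairing with y, (E4) gives S(y, x ⋄ 𝒟u) = ρ(x)ρ(y)u - ρ(x ⋄ y)u, which is ρ(y)ρ(x)u by (E6). -/
theorem dia_D [FiniteDimensional ℝ EM] [IsManifold I ∞ M] [T2Space M] [FiniteDimensional ℝ F₀]
    [ContMDiffVectorBundle ∞ F₀ K₀ I] (x : Sec I F₀ K₀) (u : Sec I F E) :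
    A.dia₀₁ x (A.D u) = A.D (A.rho x u) := by
  refine A.eq_of_S_left fun y => ?_
  have h := A.rho_S x y (A.D u)
  rw [A.S_D, A.S_D, A.rho_dia] at h
  rw [A.S_D]
  exact add_left_cancel (h.symm.trans (sub_add_cancel _ _).symm)

variable [FiniteDimensional ℝ EM] [IsManifold I ∞ M] [T2Space M]
  [FiniteDimensional ℝ F] [ContMDiffVectorBundle ∞ F E I]
  [FiniteDimensional ℝ F₁] [ContMDiffVectorBundle ∞ F₁ K₁ I]
  [FiniteDimensional ℝ F₀] [ContMDiffVectorBundle ∞ F₀ K₀ I]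

/-- On values of S, ρ(∂a)S(x, b) = S(∂a, 𝒟S(x, b)) = S(∂𝒟S(x, b), a) = 0; surjectivity of S then
forces the operator itself to vanish. -/
theorem rho_bd (a : Sec I F₁ K₁) (u : Sec I F E) : A.rho (A.bdSec a) u = 0 := by
  have h : ∀ x b, A.rho (A.bdSec a) (A.S x b) = 0 := fun x b => by
    rw [← A.S_D, A.S_bd, A.bd_D_S, map_zero, LinearMap.zero_apply]
  ext m
  have := A.covDiffOp_eq_zero (A.anchor m (A.bd m (a m))).2
    fun x b => congrArg (fun s : Sec I F E => s m) (h x b)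
  exact DFunLike.congr_fun this u

/-- By (E3), S(∂𝒟u, a) = S(∂a, 𝒟u) = ρ(∂a)u. -/
theorem bd_D (u : Sec I F E) : A.bdSec (A.D u) = 0 := by
  refine A.eq_of_S_right fun a => ?_
  rw [A.S_bd, A.S_D, A.rho_bd, map_zero, LinearMap.zero_apply]

end ECLWXTwoAlgebroid

end AlgebroidLemmas

/-! ### Alternating maps in two, three and four variables -/

section AlternatingConstructors

variable {V W : Type*} [AddCommGroup V] [Module ℝ V] [AddCommGroup W] [Module ℝ W]

/-- An alternating map of two variables from an alternating bilinear function. -/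
def altTwo (b : V → V → W) (a₁ : ∀ x y z, b (x + y) z = b x z + b y z)
    (a₂ : ∀ x y z, b x (y + z) = b x y + b x z) (s₁ : ∀ (c : ℝ) x y, b (c • x) y = c • b x y)
    (s₂ : ∀ (c : ℝ) x y, b x (c • y) = c • b x y) (h : ∀ x, b x x = 0) : V [⋀^Fin 2]→ₗ[ℝ] W :=
  { MultilinearMap.mk' (fun v : Fin 2 → V => b (v 0) (v 1))
      (fun v i x y => by fin_cases i <;> simp [a₁, a₂])
      (fun v i c x => by fin_cases i <;> simp [s₁, s₂]) with
    map_eq_zero_of_eq' v i j hv hij := by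
      change b (v 0) (v 1) = 0
      fin_cases i <;> fin_cases j <;> first
        | exact absurd rfl hij
        | (simp only [Fin.zero_eta, Fin.mk_one] at hv; simp [hv, h]) }

/-- An alternating map of three variables from an alternating trilinear function. -/
def altThree (b : V → V → V → W)
    (a₁ : ∀ x x' y z, b (x + x') y z = b x y z + b x' y z)
    (a₂ : ∀ x y y' z, b x (y + y') z = b x y z + b x y' z)
    (a₃ : ∀ x y z z', b x y (z + z') = b x y z + b x y z')
    (s₁ : ∀ (c : ℝ) x y z, b (c • x) y z = c • b x y z)
    (s₂ : ∀ (c : ℝ) x y z, b x (c • y) z = c • b x y z)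
    (s₃ : ∀ (c : ℝ) x y z, b x y (c • z) = c • b x y z)
    (h₁₂ : ∀ x y, b x x y = 0) (h₂₃ : ∀ x y, b y x x = 0) (h₁₃ : ∀ x y, b x y x = 0) :
    V [⋀^Fin 3]→ₗ[ℝ] W :=
  { MultilinearMap.mk' (fun v : Fin 3 → V => b (v 0) (v 1) (v 2))
      (fun v i x y => by fin_cases i <;> simp [a₁, a₂, a₃])
      (fun v i c x => by fin_cases i <;> simp [s₁, s₂, s₃]) with
    map_eq_zero_of_eq' v i j hv hij := by
      change b (v 0) (v 1) (v 2) = 0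
      fin_cases i <;> fin_cases j <;> first
        | exact absurd rfl hij
        | (simp only [Fin.zero_eta, Fin.mk_one, Fin.reduceFinMk] at hv
           simp [hv, h₁₂, h₂₃, h₁₃]) }

/-- An alternating map of four variables from an alternating quadrilinear function. -/
def altFour (b : V → V → V → V → W)
    (a₁ : ∀ x x' y z w, b (x + x') y z w = b x y z w + b x' y z w)
    (a₂ : ∀ x y y' z w, b x (y + y') z w = b x y z w + b x y' z w)
    (a₃ : ∀ x y z z' w, b x y (z + z') w = b x y z w + b x y z' w)
    (a₄ : ∀ x y z w w', b x y z (w + w') = b x y z w + b x y z w')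
    (s₁ : ∀ (c : ℝ) x y z w, b (c • x) y z w = c • b x y z w)
    (s₂ : ∀ (c : ℝ) x y z w, b x (c • y) z w = c • b x y z w)
    (s₃ : ∀ (c : ℝ) x y z w, b x y (c • z) w = c • b x y z w)
    (s₄ : ∀ (c : ℝ) x y z w, b x y z (c • w) = c • b x y z w)
    (h₁₂ : ∀ x y z, b x x y z = 0) (h₂₃ : ∀ x y z, b y x x z = 0) (h₃₄ : ∀ x y z, b y z x x = 0)
    (h₁₃ : ∀ x y z, b x y x z = 0) (h₂₄ : ∀ x y z, b y x z x = 0) (h₁₄ : ∀ x y z, b x y z x = 0) :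
    V [⋀^Fin 4]→ₗ[ℝ] W :=
  { MultilinearMap.mk' (fun v : Fin 4 → V => b (v 0) (v 1) (v 2) (v 3))
      (fun v i x y => by fin_cases i <;> simp [a₁, a₂, a₃, a₄])
      (fun v i c x => by fin_cases i <;> simp [s₁, s₂, s₃, s₄]) with
    map_eq_zero_of_eq' v i j hv hij := by
      change b (v 0) (v 1) (v 2) (v 3) = 0
      fin_cases i <;> fin_cases j <;> first
        | exact absurd rfl hij
        | (simp only [Fin.zero_eta, Fin.mk_one, Fin.reduceFinMk] at hv
           simp [hv, h₁₂, h₂₃, h₃₄, h₁₃, h₂₄, h₁₄]) }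

end AlternatingConstructors

/-! ### Skew-symmetrised data and the four brackets -/

/-- The algebraic data carried by the sections of an `E`-CLWX 2-algebroid, in terms of the
skew-symmetrised products `br x y = ⟦x, y⟧` and `act x a = ⟦x, a⟧`. -/
structure SkewCLWX (L₂ L₁ L₀ : Type*) [AddCommGroup L₂] [Module ℝ L₂] [AddCommGroup L₁]
    [Module ℝ L₁] [AddCommGroup L₀] [Module ℝ L₀] where
  d : L₁ →ₗ[ℝ] L₀
  D : L₂ →ₗ[ℝ] L₁
  rho : L₀ →ₗ[ℝ] L₂ →ₗ[ℝ] L₂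
  S : L₀ →ₗ[ℝ] L₁ →ₗ[ℝ] L₂
  br : L₀ →ₗ[ℝ] L₀ →ₗ[ℝ] L₀
  act : L₀ →ₗ[ℝ] L₁ →ₗ[ℝ] L₁
  Om : L₀ →ₗ[ℝ] L₀ →ₗ[ℝ] L₀ →ₗ[ℝ] L₁
  br_self : ∀ x, br x x = 0
  Om_self₁₂ : ∀ x y, Om x x y = 0
  Om_self₂₃ : ∀ x y, Om x y y = 0
  S_Om : ∀ x y z w, S w (Om x y z) = -S z (Om x y w)
  d_act : ∀ x a, d (act x a) = br x (d a)
  act_d : ∀ a b, act (d a) b = -act (d b) a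
  d_D : ∀ u, d (D u) = 0
  rho_d : ∀ a u, rho (d a) u = 0
  S_D : ∀ x u, S x (D u) = rho x u
  S_d : ∀ a b, S (d a) b = S (d b) a
  act_D : ∀ x u, act x (D u) = (1 / 2 : ℝ) • D (rho x u)
  rho_br : ∀ x y u, rho (br x y) u = rho x (rho y u) - rho y (rho x u)
  S_act : ∀ x y a, S y (act x a) = rho x (S y a) - S (br x y) a - (1 / 2 : ℝ) • rho y (S x a)
  d_Om : ∀ x y z, d (Om x y z) = -(br (br x y) z + br (br y z) x + br (br z x) y)
  Om_d : ∀ x y a, Om x y (d a) = act x (act y a) - act y (act x a) - act (br x y) a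
    + D ((1 / 2 : ℝ) • S (br x y) a - (1 / 4 : ℝ) • (rho x (S y a) - rho y (S x a)))
  act_Om : ∀ w x y z, act w (Om x y z) - act x (Om w y z) + act y (Om w x z) - act z (Om w x y)
    - D (S z (Om w x y)) = Om (br w x) y z + Om x (br w y) z + Om x y (br w z)
      - Om w (br x y) z - Om w y (br x z) + Om w x (br y z)

namespace SkewCLWX

variable {L₂ L₁ L₀ : Type*} [AddCommGroup L₂] [Module ℝ L₂] [AddCommGroup L₁]
  [Module ℝ L₁] [AddCommGroup L₀] [Module ℝ L₀] (A : SkewCLWX L₂ L₁ L₀)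

theorem br_skew (x y : L₀) : A.br y x = -A.br x y := by
  have h := A.br_self (x + y)
  simp only [map_add, LinearMap.add_apply, A.br_self, zero_add, add_zero] at h
  exact eq_neg_of_add_eq_zero_left h

theorem Om_skew₁₂ (x y z : L₀) : A.Om y x z = -A.Om x y z := by
  have h := A.Om_self₁₂ (x + y) z
  simp only [map_add, LinearMap.add_apply, A.Om_self₁₂, zero_add, add_zero] at h
  exact eq_neg_of_add_eq_zero_left h

theorem Om_skew₂₃ (x y z : L₀) : A.Om x z y = -A.Om x y z := by
  have h := A.Om_self₂₃ x (y + z)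
  simp only [map_add, LinearMap.add_apply, A.Om_self₂₃, zero_add, add_zero] at h
  exact eq_neg_of_add_eq_zero_left h

theorem S_Om_self (x y z : L₀) : A.S z (A.Om x y z) = 0 := by
  have h := A.S_Om x y z z
  linear_combination (norm := module) (1 / 2 : ℝ) • h

/-- The trilinear map `T`. -/
def T (x y : L₀) (a : L₁) : L₂ :=
  (1 / 2 : ℝ) • A.S (A.br x y) a - (1 / 4 : ℝ) • (A.rho x (A.S y a) - A.rho y (A.S x a))

theorem T_skew (x y : L₀) (a : L₁) : A.T y x a = -A.T x y a := by
  rw [T, T, A.br_skew, map_neg, LinearMap.neg_apply]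
  module

theorem T_self (x : L₀) (a : L₁) : A.T x x a = 0 := by
  rw [T, A.br_self]
  simp

/-- The bracket `𝔩₁`. -/
def b₁ (X : L₂ × L₁ × L₀) : L₂ × L₁ × L₀ := (0, A.D X.1, A.d X.2.1)

/-- The bracket `𝔩₂`. -/
def b₂ (X Y : L₂ × L₁ × L₀) : L₂ × L₁ × L₀ :=
  ((1 / 2 : ℝ) • A.rho X.2.2 Y.1 - (1 / 2 : ℝ) • A.rho Y.2.2 X.1,
    A.act X.2.2 Y.2.1 - A.act Y.2.2 X.2.1, A.br X.2.2 Y.2.2)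

/-- The bracket `𝔩₃`. -/
def b₃ (X Y Z : L₂ × L₁ × L₀) : L₂ × L₁ × L₀ :=
  (-(A.T X.2.2 Y.2.2 Z.2.1 + A.T Y.2.2 Z.2.2 X.2.1 + A.T Z.2.2 X.2.2 Y.2.1),
    A.Om X.2.2 Y.2.2 Z.2.2, 0)

/-- The bracket `𝔩₄`. -/
def b₄ (X Y Z W : L₂ × L₁ × L₀) : L₂ × L₁ × L₀ :=
  (A.S W.2.2 (A.Om X.2.2 Y.2.2 Z.2.2), 0, 0)

/-- The bracket `𝔩₁` as an alternating map. -/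
def l₁ : (L₂ × L₁ × L₀) [⋀^Fin 1]→ₗ[ℝ] (L₂ × L₁ × L₀) :=
  { MultilinearMap.mk' (fun v => A.b₁ (v 0))
      (fun v i X Y => by fin_cases i; simp [b₁])
      (fun v i c X => by fin_cases i; simp [b₁]) with
    map_eq_zero_of_eq' v i j _ hij := absurd (Subsingleton.elim i j) hij }

/-- The bracket `𝔩₂` as an alternating map. -/
def l₂ : (L₂ × L₁ × L₀) [⋀^Fin 2]→ₗ[ℝ] (L₂ × L₁ × L₀) :=
  altTwo A.b₂
    (fun X Y Z => by ext <;> simp [b₂] <;> module) (fun X Y Z => by ext <;> simp [b₂] <;> module)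
    (fun c X Y => by ext <;> simp [b₂] <;> module) (fun c X Y => by ext <;> simp [b₂] <;> module)
    (fun X => by ext <;> simp [b₂, A.br_self])

/-- The bracket `𝔩₃` as an alternating map. -/
def l₃ : (L₂ × L₁ × L₀) [⋀^Fin 3]→ₗ[ℝ] (L₂ × L₁ × L₀) :=
  altThree A.b₃
    (fun X X' Y Z => by ext <;> simp [b₃, T]; module)
    (fun X Y Y' Z => by ext <;> simp [b₃, T]; module)
    (fun X Y Z Z' => by ext <;> simp [b₃, T]; module)
    (fun c X Y Z => by ext <;> simp [b₃, T]; module)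
    (fun c X Y Z => by ext <;> simp [b₃, T]; module)
    (fun c X Y Z => by ext <;> simp [b₃, T]; module)
    (fun X Y => by
      ext <;> simp only [b₃, A.Om_self₁₂, A.T_self, A.T_skew Y.2.2 X.2.2, Prod.fst_zero,
        Prod.snd_zero]
      abel)
    (fun X Y => by
      ext <;> simp only [b₃, A.Om_self₂₃, A.T_self, A.T_skew Y.2.2 X.2.2, Prod.fst_zero,
        Prod.snd_zero]
      abel)
    (fun X Y => by
      ext <;> simp only [b₃, A.Om_skew₁₂ Y.2.2 X.2.2, A.Om_self₂₃, A.T_self, A.T_skew Y.2.2 X.2.2,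
        Prod.fst_zero, Prod.snd_zero, neg_zero]
      abel)

/-- The bracket `𝔩₄` as an alternating map. -/
def l₄ : (L₂ × L₁ × L₀) [⋀^Fin 4]→ₗ[ℝ] (L₂ × L₁ × L₀) :=
  altFour A.b₄
    (fun X X' Y Z W => by simp [b₄]) (fun X Y Y' Z W => by simp [b₄])
    (fun X Y Z Z' W => by simp [b₄]) (fun X Y Z W W' => by simp [b₄])
    (fun c X Y Z W => by simp [b₄]) (fun c X Y Z W => by simp [b₄])
    (fun c X Y Z W => by simp [b₄]) (fun c X Y Z W => by simp [b₄])
    (fun X Y Z => by simp [b₄, A.Om_self₁₂]) (fun X Y Z => by simp [b₄, A.Om_self₂₃])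
    (fun X Y Z => by simp [b₄, A.S_Om_self])
    (fun X Y Z => by simp [b₄, A.Om_skew₁₂ Y.2.2 X.2.2, A.Om_self₂₃])
    (fun X Y Z => by simp [b₄, A.Om_skew₂₃ _ Z.2.2 X.2.2, A.S_Om_self])
    (fun X Y Z => by simp [b₄, A.Om_skew₁₂ Y.2.2 X.2.2, A.Om_skew₂₃ _ Z.2.2 X.2.2, A.S_Om_self])

/-- The brackets of the Lie 3-algebra, as alternating maps on the total space. -/
def bracket : (k : ℕ) → (L₂ × L₁ × L₀) [⋀^Fin k]→ₗ[ℝ] (L₂ × L₁ × L₀)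
  | 1 => A.l₁
  | 2 => A.l₂
  | 3 => A.l₃
  | 4 => A.l₄
  | _ => 0

theorem bracket_one (v : Fin 1 → L₂ × L₁ × L₀) : A.bracket 1 v = A.b₁ (v 0) := rfl

theorem bracket_two (v : Fin 2 → L₂ × L₁ × L₀) : A.bracket 2 v = A.b₂ (v 0) (v 1) := rfl

theorem bracket_three (v : Fin 3 → L₂ × L₁ × L₀) : A.bracket 3 v = A.b₃ (v 0) (v 1) (v 2) := rfl

theorem bracket_four (v : Fin 4 → L₂ × L₁ × L₀) :
    A.bracket 4 v = A.b₄ (v 0) (v 1) (v 2) (v 3) := rfl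

end SkewCLWX

/-! ### Degrees and graded skew-symmetry -/

section Graded

variable {L₂ L₁ L₀ : Type*} [AddCommGroup L₂] [Module ℝ L₂] [AddCommGroup L₁]
  [Module ℝ L₁] [AddCommGroup L₀] [Module ℝ L₀]

theorem mem_gradedPart {d : ℤ} {v : L₂ × L₁ × L₀} : v ∈ gradedPart L₂ L₁ L₀ d ↔
    (d ≠ -2 → v.1 = 0) ∧ (d ≠ -1 → v.2.1 = 0) ∧ (d ≠ 0 → v.2.2 = 0) := Iff.rfl

theorem eq_zero_of_mem_gradedPart {d : ℤ} {v : L₂ × L₁ × L₀} (hv : v ∈ gradedPart L₂ L₁ L₀ d)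
    (h₂ : d ≠ -2) (h₁ : d ≠ -1) (h₀ : d ≠ 0) : v = 0 :=
  Prod.ext (hv.1 h₂) (Prod.ext (hv.2.1 h₁) (hv.2.2 h₀))

/-- With at most one entry of nonzero degree, each exponent is a product with a zero factor. -/
theorem koszulSign_eq_one {k : ℕ} {d : Fin k → ℤ} (h : ∀ a b, a ≠ b → d a = 0 ∨ d b = 0)
    (σ : Equiv.Perm (Fin k)) : koszulSign d σ = 1 := by
  refine Finset.prod_eq_one fun p hp => ?_
  have hne : p.1 ≠ p.2 := (Finset.mem_filter.1 hp).2.1.ne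
  rcases h _ _ (fun e => hne (σ.injective e)) with h | h <;> simp [h]

end Graded

namespace SkewCLWX

variable {L₂ L₁ L₀ : Type*} [AddCommGroup L₂] [Module ℝ L₂] [AddCommGroup L₁]
  [Module ℝ L₁] [AddCommGroup L₀] [Module ℝ L₀] (A : SkewCLWX L₂ L₁ L₀)

theorem T_eq_zero {x y : L₀} {a : L₁} (h : x = 0 ∨ y = 0 ∨ a = 0) : A.T x y a = 0 := by
  rcases h with rfl | rfl | rfl <;> simp [T]

theorem Om_eq_zero {x y z : L₀} (h : x = 0 ∨ y = 0 ∨ z = 0) : A.Om x y z = 0 := by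
  rcases h with rfl | rfl | rfl <;> simp

theorem map₂_eq_zero {P Q R : Type*} [AddCommGroup P] [Module ℝ P] [AddCommGroup Q] [Module ℝ Q]
    [AddCommGroup R] [Module ℝ R] (f : P →ₗ[ℝ] Q →ₗ[ℝ] R) {p : P} {q : Q} (h : p = 0 ∨ q = 0) :
    f p q = 0 := by
  rcases h with rfl | rfl <;> simp

theorem b₁_mem {d : ℤ} {X : L₂ × L₁ × L₀} (hX : X ∈ gradedPart L₂ L₁ L₀ d) :
    A.b₁ X ∈ gradedPart L₂ L₁ L₀ (d + 1) := by
  refine ⟨fun _ => rfl, fun h => ?_, fun h => ?_⟩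
  · change A.D X.1 = 0
    rw [hX.1 (by omega), map_zero]
  · change A.d X.2.1 = 0
    rw [hX.2.1 (by omega), map_zero]

theorem b₂_mem {d e : ℤ} {X Y : L₂ × L₁ × L₀} (hX : X ∈ gradedPart L₂ L₁ L₀ d)
    (hY : Y ∈ gradedPart L₂ L₁ L₀ e) : A.b₂ X Y ∈ gradedPart L₂ L₁ L₀ (d + e) := by
  rw [mem_gradedPart] at *
  refine ⟨fun h => ?_, fun h => ?_, fun h => ?_⟩
  · simp only [b₂]
    rw [map₂_eq_zero A.rho (p := X.2.2) (by grind), map₂_eq_zero A.rho (p := Y.2.2) (by grind)]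
    simp
  · simp only [b₂]
    rw [map₂_eq_zero A.act (p := X.2.2) (by grind), map₂_eq_zero A.act (p := Y.2.2) (by grind)]
    simp
  · exact map₂_eq_zero A.br (by grind)

theorem b₃_mem {d e f : ℤ} {X Y Z : L₂ × L₁ × L₀} (hX : X ∈ gradedPart L₂ L₁ L₀ d)
    (hY : Y ∈ gradedPart L₂ L₁ L₀ e) (hZ : Z ∈ gradedPart L₂ L₁ L₀ f) :
    A.b₃ X Y Z ∈ gradedPart L₂ L₁ L₀ (d + e + f - 1) := by
  rw [mem_gradedPart] at *
  refine ⟨fun h => ?_, fun h => ?_, fun h => rfl⟩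
  · simp only [b₃]
    rw [A.T_eq_zero (x := X.2.2) (by grind), A.T_eq_zero (x := Y.2.2) (by grind),
      A.T_eq_zero (x := Z.2.2) (by grind)]
    simp
  · exact A.Om_eq_zero (by grind)

theorem b₄_mem {d e f g : ℤ} {X Y Z W : L₂ × L₁ × L₀} (hX : X ∈ gradedPart L₂ L₁ L₀ d)
    (hY : Y ∈ gradedPart L₂ L₁ L₀ e) (hZ : Z ∈ gradedPart L₂ L₁ L₀ f)
    (hW : W ∈ gradedPart L₂ L₁ L₀ g) :
    A.b₄ X Y Z W ∈ gradedPart L₂ L₁ L₀ (d + e + f + g - 2) := by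
  rw [mem_gradedPart] at *
  refine ⟨fun h => ?_, fun _ => rfl, fun _ => rfl⟩
  have : W.2.2 = 0 ∨ A.Om X.2.2 Y.2.2 Z.2.2 = 0 := by
    by_cases hW' : W.2.2 = 0
    · exact Or.inl hW'
    · exact Or.inr (A.Om_eq_zero (by grind))
  exact map₂_eq_zero A.S this

theorem bracket_mem (k : ℕ) (d : Fin k → ℤ) (x : Fin k → L₂ × L₁ × L₀)
    (hx : ∀ a, x a ∈ gradedPart L₂ L₁ L₀ (d a)) :
    A.bracket k x ∈ gradedPart L₂ L₁ L₀ (∑ a, d a + 2 - (k : ℤ)) := by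
  match k with
  | 0 => exact Submodule.zero_mem _
  | 1 =>
    rw [bracket_one]
    convert A.b₁_mem (hx 0) using 1
    simp; ring_nf
  | 2 =>
    rw [bracket_two]
    convert A.b₂_mem (hx 0) (hx 1) using 1
    simp [Fin.sum_univ_two]
  | 3 =>
    rw [bracket_three]
    convert A.b₃_mem (hx 0) (hx 1) (hx 2) using 1
    simp [Fin.sum_univ_three]; ring_nf
  | 4 =>
    rw [bracket_four]
    convert A.b₄_mem (hx 0) (hx 1) (hx 2) (hx 3) using 1
    simp [Fin.sum_univ_four]; ring_nf
  | k + 5 => exact Submodule.zero_mem _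

/-- For k ≥ 2, every term of every bracket takes the degree 0 component of all its arguments except
at most one. -/
theorem bracket_eq_zero_of_ne {k : ℕ} {d : Fin k → ℤ} {x : Fin k → L₂ × L₁ × L₀}
    (hx : ∀ a, x a ∈ gradedPart L₂ L₁ L₀ (d a)) {a b : Fin k} (hab : a ≠ b) (ha : d a ≠ 0)
    (hb : d b ≠ 0) : A.bracket k x = 0 := by
  have hxa := (hx a).2.2 ha
  have hxb := (hx b).2.2 hb
  match k with
  | 1 => exact absurd (Subsingleton.elim a b) hab
  | 2 =>
    have h : (x 0).2.2 = 0 ∧ (x 1).2.2 = 0 := by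
      fin_cases a <;> fin_cases b <;> simp_all
    ext <;> simp [bracket_two, b₂, h]
  | 3 =>
    have h : ((x 0).2.2 = 0 ∧ (x 1).2.2 = 0) ∨ ((x 1).2.2 = 0 ∧ (x 2).2.2 = 0) ∨
        ((x 0).2.2 = 0 ∧ (x 2).2.2 = 0) := by
      fin_cases a <;> fin_cases b <;> simp_all
    rcases h with ⟨h, h'⟩ | ⟨h, h'⟩ | ⟨h, h'⟩ <;> ext <;> simp [bracket_three, b₃, T, h, h']
  | 4 =>
    have h : (x 0).2.2 = 0 ∨ (x 1).2.2 = 0 ∨ (x 2).2.2 = 0 ∨ (x 3).2.2 = 0 := by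
      fin_cases a <;> simp_all
    rcases h with h | h | h | h <;> simp [bracket_four, b₄, h]
  | k + 5 => rfl

/-- If two entries have nonzero degree, both sides vanish; otherwise the Koszul sign is 1 and
ordinary alternation suffices. -/
theorem bracket_perm (k : ℕ) (d : Fin k → ℤ) (x : Fin k → L₂ × L₁ × L₀)
    (hx : ∀ a, x a ∈ gradedPart L₂ L₁ L₀ (d a)) (σ : Equiv.Perm (Fin k)) :
    A.bracket k (fun a => x (σ a)) =
      ((Equiv.Perm.sign σ * koszulSign d σ : ℤˣ) : ℤ) • A.bracket k x := by
  by_cases h : ∀ a b, a ≠ b → d a = 0 ∨ d b = 0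
  · rw [koszulSign_eq_one h, mul_one]
    exact (A.bracket k).map_perm x σ
  · push Not at h
    obtain ⟨a, b, hab, ha, hb⟩ := h
    rw [A.bracket_eq_zero_of_ne hx hab ha hb, smul_zero]
    refine A.bracket_eq_zero_of_ne (d := fun a => d (σ a)) (fun a => hx (σ a))
      (a := σ.symm a) (b := σ.symm b) (by simpa using hab) ?_ ?_ <;> simpa

end SkewCLWX

/-! ### Explicit sums over unshuffles -/

section Unshuffles

variable {V : Type*} [AddCommGroup V]

/-- Separates the enumeration of unshuffles with their signs, a finite decidable statement, from the
summand with values in an abstract group. -/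
theorem sum_unshuffle_eq_sum_map {k p : ℕ} {s : Multiset (ℤˣ × (Fin k → Fin k))}
    (hs : (Finset.univ.filter (IsUnshuffle (k := k) p)).val.map
      (fun σ => (Equiv.Perm.sign σ, (σ : Fin k → Fin k))) = s) (g : (Fin k → Fin k) → V) :
    ∑ σ : Equiv.Perm (Fin k) with IsUnshuffle p σ, ((Equiv.Perm.sign σ : ℤˣ) : ℤ) • g σ =
      (s.map fun q => (q.1 : ℤ) • g q.2).sum := by
  rw [← hs, Multiset.map_map]
  rfl

theorem sum_unshuffle_three_one (g : Fin 3 → Fin 3 → Fin 3 → V) :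
    ∑ σ : Equiv.Perm (Fin 3) with IsUnshuffle 1 σ,
      ((Equiv.Perm.sign σ : ℤˣ) : ℤ) • g (σ 0) (σ 1) (σ 2) =
        g 0 1 2 - g 1 0 2 + g 2 0 1 := by
  rw [sum_unshuffle_eq_sum_map (k := 3) (p := 1)
    (s := {(1, ![0, 1, 2]), (-1, ![1, 0, 2]), (1, ![2, 0, 1])})
    (by decide +kernel) (fun σ => g (σ 0) (σ 1) (σ 2))]
  simp
  abel

theorem sum_unshuffle_three_two (g : Fin 3 → Fin 3 → Fin 3 → V) :
    ∑ σ : Equiv.Perm (Fin 3) with IsUnshuffle 2 σ,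
      ((Equiv.Perm.sign σ : ℤˣ) : ℤ) • g (σ 0) (σ 1) (σ 2) =
        g 0 1 2 - g 0 2 1 + g 1 2 0 := by
  rw [sum_unshuffle_eq_sum_map (k := 3) (p := 2)
    (s := {(1, ![0, 1, 2]), (-1, ![0, 2, 1]), (1, ![1, 2, 0])})
    (by decide +kernel) (fun σ => g (σ 0) (σ 1) (σ 2))]
  simp
  abel

theorem sum_unshuffle_three_three (g : Fin 3 → Fin 3 → Fin 3 → V) :
    ∑ σ : Equiv.Perm (Fin 3) with IsUnshuffle 3 σ,
      ((Equiv.Perm.sign σ : ℤˣ) : ℤ) • g (σ 0) (σ 1) (σ 2) =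
        g 0 1 2 := by
  rw [sum_unshuffle_eq_sum_map (k := 3) (p := 3)
    (s := {(1, ![0, 1, 2])})
    (by decide +kernel) (fun σ => g (σ 0) (σ 1) (σ 2))]
  simp

theorem sum_unshuffle_four_one (g : Fin 4 → Fin 4 → Fin 4 → Fin 4 → V) :
    ∑ σ : Equiv.Perm (Fin 4) with IsUnshuffle 1 σ,
      ((Equiv.Perm.sign σ : ℤˣ) : ℤ) • g (σ 0) (σ 1) (σ 2) (σ 3) =
        g 0 1 2 3 - g 1 0 2 3 + g 2 0 1 3 - g 3 0 1 2 := by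
  rw [sum_unshuffle_eq_sum_map (k := 4) (p := 1)
    (s := {(1, ![0, 1, 2, 3]), (-1, ![1, 0, 2, 3]), (1, ![2, 0, 1, 3]), (-1, ![3, 0, 1, 2])})
    (by decide +kernel) (fun σ => g (σ 0) (σ 1) (σ 2) (σ 3))]
  simp
  abel

theorem sum_unshuffle_four_two (g : Fin 4 → Fin 4 → Fin 4 → Fin 4 → V) :
    ∑ σ : Equiv.Perm (Fin 4) with IsUnshuffle 2 σ,
      ((Equiv.Perm.sign σ : ℤˣ) : ℤ) • g (σ 0) (σ 1) (σ 2) (σ 3) =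
        g 0 1 2 3 - g 0 2 1 3 + g 0 3 1 2 + g 1 2 0 3 - g 1 3 0 2 + g 2 3 0 1 := by
  rw [sum_unshuffle_eq_sum_map (k := 4) (p := 2)
    (s := {(1, ![0, 1, 2, 3]), (-1, ![0, 2, 1, 3]), (1, ![0, 3, 1, 2]), (1, ![1, 2, 0, 3]), (-1,
      ![1, 3, 0, 2]), (1, ![2, 3, 0, 1])})
    (by decide +kernel) (fun σ => g (σ 0) (σ 1) (σ 2) (σ 3))]
  simp
  abel

theorem sum_unshuffle_four_three (g : Fin 4 → Fin 4 → Fin 4 → Fin 4 → V) :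
    ∑ σ : Equiv.Perm (Fin 4) with IsUnshuffle 3 σ,
      ((Equiv.Perm.sign σ : ℤˣ) : ℤ) • g (σ 0) (σ 1) (σ 2) (σ 3) =
        g 0 1 2 3 - g 0 1 3 2 + g 0 2 3 1 - g 1 2 3 0 := by
  rw [sum_unshuffle_eq_sum_map (k := 4) (p := 3)
    (s := {(1, ![0, 1, 2, 3]), (-1, ![0, 1, 3, 2]), (1, ![0, 2, 3, 1]), (-1, ![1, 2, 3, 0])})
    (by decide +kernel) (fun σ => g (σ 0) (σ 1) (σ 2) (σ 3))]
  simp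
  abel

theorem sum_unshuffle_four_four (g : Fin 4 → Fin 4 → Fin 4 → Fin 4 → V) :
    ∑ σ : Equiv.Perm (Fin 4) with IsUnshuffle 4 σ,
      ((Equiv.Perm.sign σ : ℤˣ) : ℤ) • g (σ 0) (σ 1) (σ 2) (σ 3) =
        g 0 1 2 3 := by
  rw [sum_unshuffle_eq_sum_map (k := 4) (p := 4)
    (s := {(1, ![0, 1, 2, 3])})
    (by decide +kernel) (fun σ => g (σ 0) (σ 1) (σ 2) (σ 3))]
  simp

theorem sum_unshuffle_five_two (g : Fin 5 → Fin 5 → Fin 5 → Fin 5 → Fin 5 → V) :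
    ∑ σ : Equiv.Perm (Fin 5) with IsUnshuffle 2 σ,
      ((Equiv.Perm.sign σ : ℤˣ) : ℤ) • g (σ 0) (σ 1) (σ 2) (σ 3) (σ 4) =
        g 0 1 2 3 4 - g 0 2 1 3 4 + g 0 3 1 2 4 - g 0 4 1 2 3 + g 1 2 0 3 4 - g 1 3 0 2 4
        + g 1 4 0 2 3 + g 2 3 0 1 4 - g 2 4 0 1 3 + g 3 4 0 1 2 := by
  rw [sum_unshuffle_eq_sum_map (k := 5) (p := 2)
    (s := {(1, ![0, 1, 2, 3, 4]), (-1, ![0, 2, 1, 3, 4]), (1, ![0, 3, 1, 2, 4]), (-1, ![0, 4, 1,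
      2, 3]), (1, ![1, 2, 0, 3, 4]), (-1, ![1, 3, 0, 2, 4]), (1, ![1, 4, 0, 2, 3]), (1,
      ![2, 3, 0, 1, 4]), (-1, ![2, 4, 0, 1, 3]), (1, ![3, 4, 0, 1, 2])})
    (by decide +kernel) (fun σ => g (σ 0) (σ 1) (σ 2) (σ 3) (σ 4))]
  simp
  abel

theorem sum_unshuffle_five_three (g : Fin 5 → Fin 5 → Fin 5 → Fin 5 → Fin 5 → V) :
    ∑ σ : Equiv.Perm (Fin 5) with IsUnshuffle 3 σ,
      ((Equiv.Perm.sign σ : ℤˣ) : ℤ) • g (σ 0) (σ 1) (σ 2) (σ 3) (σ 4) =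
        g 0 1 2 3 4 - g 0 1 3 2 4 + g 0 1 4 2 3 + g 0 2 3 1 4 - g 0 2 4 1 3 + g 0 3 4 1 2
        - g 1 2 3 0 4 + g 1 2 4 0 3 - g 1 3 4 0 2 + g 2 3 4 0 1 := by
  rw [sum_unshuffle_eq_sum_map (k := 5) (p := 3)
    (s := {(1, ![0, 1, 2, 3, 4]), (-1, ![0, 1, 3, 2, 4]), (1, ![0, 1, 4, 2, 3]), (1, ![0, 2, 3, 1,
      4]), (-1, ![0, 2, 4, 1, 3]), (1, ![0, 3, 4, 1, 2]), (-1, ![1, 2, 3, 0, 4]), (1,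
      ![1, 2, 4, 0, 3]), (-1, ![1, 3, 4, 0, 2]), (1, ![2, 3, 4, 0, 1])})
    (by decide +kernel) (fun σ => g (σ 0) (σ 1) (σ 2) (σ 3) (σ 4))]
  simp
  abel

theorem sum_unshuffle_five_four (g : Fin 5 → Fin 5 → Fin 5 → Fin 5 → Fin 5 → V) :
    ∑ σ : Equiv.Perm (Fin 5) with IsUnshuffle 4 σ,
      ((Equiv.Perm.sign σ : ℤˣ) : ℤ) • g (σ 0) (σ 1) (σ 2) (σ 3) (σ 4) =
        g 0 1 2 3 4 - g 0 1 2 4 3 + g 0 1 3 4 2 - g 0 2 3 4 1 + g 1 2 3 4 0 := by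
  rw [sum_unshuffle_eq_sum_map (k := 5) (p := 4)
    (s := {(1, ![0, 1, 2, 3, 4]), (-1, ![0, 1, 2, 4, 3]), (1, ![0, 1, 3, 4, 2]), (-1, ![0, 2, 3,
      4, 1]), (1, ![1, 2, 3, 4, 0])})
    (by decide +kernel) (fun σ => g (σ 0) (σ 1) (σ 2) (σ 3) (σ 4))]
  simp
  abel

/-- The Koszul sign depends only on the underlying function of σ, so the same enumeration serves the
sums with Koszul signs. -/
theorem sum_unshuffle_koszul_eq_sum_map {k p : ℕ} {s : Multiset (ℤˣ × (Fin k → Fin k))}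
    (hs : (Finset.univ.filter (IsUnshuffle (k := k) p)).val.map
      (fun σ => (Equiv.Perm.sign σ, (σ : Fin k → Fin k))) = s) (d : Fin k → ℤ)
    (g : (Fin k → Fin k) → V) :
    ∑ σ : Equiv.Perm (Fin k) with IsUnshuffle p σ,
      ((Equiv.Perm.sign σ * koszulSign d σ : ℤˣ) : ℤ) • g σ =
    (s.map fun q => ((q.1 * ∏ r : Fin k × Fin k with r.1 < r.2 ∧ q.2 r.2 < q.2 r.1,
      Int.negOnePow (d (q.2 r.1) * d (q.2 r.2)) : ℤˣ) : ℤ) • g q.2).sum := by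
  rw [← hs, Multiset.map_map]
  rfl

theorem sum_unshuffle_two_one_koszul (d : Fin 2 → ℤ) (g : Fin 2 → Fin 2 → V) :
    ∑ σ : Equiv.Perm (Fin 2) with IsUnshuffle 1 σ,
      ((Equiv.Perm.sign σ * koszulSign d σ : ℤˣ) : ℤ) • g (σ 0) (σ 1) =
        g 0 1 - (Int.negOnePow (d 0 * d 1) : ℤ) • g 1 0 := by
  rw [sum_unshuffle_koszul_eq_sum_map (k := 2) (p := 1) (s := {(1, ![0, 1]), (-1, ![1, 0])})
    (by decide +kernel) d (fun σ => g (σ 0) (σ 1))]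
  simp [Finset.prod_filter, Fintype.prod_prod_type, Fin.prod_univ_two, mul_comm (d 1),
    sub_eq_add_neg]

theorem sum_unshuffle_two_two_koszul (d : Fin 2 → ℤ) (g : Fin 2 → Fin 2 → V) :
    ∑ σ : Equiv.Perm (Fin 2) with IsUnshuffle 2 σ,
      ((Equiv.Perm.sign σ * koszulSign d σ : ℤˣ) : ℤ) • g (σ 0) (σ 1) = g 0 1 := by
  rw [sum_unshuffle_koszul_eq_sum_map (k := 2) (p := 2) (s := {(1, ![0, 1])})
    (by decide +kernel) d (fun σ => g (σ 0) (σ 1))]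
  simp [Finset.prod_filter, Fintype.prod_prod_type, Fin.prod_univ_two]

theorem sum_unshuffle_three_one_koszul (d : Fin 3 → ℤ) (g : Fin 3 → Fin 3 → Fin 3 → V) :
    ∑ σ : Equiv.Perm (Fin 3) with IsUnshuffle 1 σ,
      ((Equiv.Perm.sign σ * koszulSign d σ : ℤˣ) : ℤ) • g (σ 0) (σ 1) (σ 2) =
        g 0 1 2 - (Int.negOnePow (d 1 * d 0) : ℤ) • g 1 0 2
          + (Int.negOnePow (d 2 * d 0) * Int.negOnePow (d 2 * d 1) : ℤ) • g 2 0 1 := by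
  rw [sum_unshuffle_koszul_eq_sum_map (k := 3) (p := 1)
    (s := {(1, ![0, 1, 2]), (-1, ![1, 0, 2]), (1, ![2, 0, 1])})
    (by decide +kernel) d (fun σ => g (σ 0) (σ 1) (σ 2))]
  simp [Finset.prod_filter, Fintype.prod_prod_type, Fin.prod_univ_three]
  abel

end Unshuffles

/-! ### Identities for T and Ω̄ -/

namespace SkewCLWX

variable {L₂ L₁ L₀ : Type*} [AddCommGroup L₂] [Module ℝ L₂] [AddCommGroup L₁]
  [Module ℝ L₁] [AddCommGroup L₀] [Module ℝ L₀] (A : SkewCLWX L₂ L₁ L₀)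

/-- By (E6) the ρρ terms form ρ(⟦x, y⟧)u, and ½ - ¼ = ¼. This settles the Jacobi identity on two
elements of degree 0 and one of degree -2. -/
theorem T_D (x y : L₀) (u : L₂) : A.T x y (A.D u) = (1 / 4 : ℝ) • A.rho (A.br x y) u := by
  rw [T, A.S_D, A.S_D, A.S_D, A.rho_br]
  module

theorem Om_d_eq (x y : L₀) (a : L₁) : A.Om x y (A.d a) =
    A.act x (A.act y a) - A.act y (A.act x a) - A.act (A.br x y) a + A.D (A.T x y a) :=
  A.Om_d x y a

/-- Since ρ∘∂ = 0, only S(⟦∂a, x⟧, b) and ρ(x)S(∂a, b) survive, and moving ∂ across S with (E3)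
makes them cancel. This is the Jacobi identity in degrees (-1, -1, 0). -/
theorem T_d_symm (x : L₀) (a b : L₁) : A.T (A.d a) x b + A.T (A.d b) x a = 0 := by
  have h₁ : A.S (A.br (A.d a) x) b = -A.S (A.d b) (A.act x a) := by
    rw [A.br_skew, ← A.d_act, map_neg, LinearMap.neg_apply, A.S_d]
  have h₂ := A.S_act x (A.d b) a
  rw [A.br_skew (A.d b), map_neg, LinearMap.neg_apply, A.rho_d, smul_zero] at h₂
  rw [T, T, A.rho_d, A.rho_d, h₁, h₂, A.S_d a b]
  module

theorem S_Om_cyc (x y z w : L₀) : A.S w (A.Om x y z) = -A.S z (A.Om w x y) := by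
  rw [A.S_Om, A.Om_skew₂₃ x w y, A.Om_skew₁₂ w x, neg_neg]

theorem Om_rot (x y z : L₀) : A.Om z x y = A.Om x y z := by
  rw [A.Om_skew₁₂ x z y, A.Om_skew₂₃ x y z, neg_neg]

theorem T_zero (x y : L₀) : A.T x y 0 = 0 := by simp [T]

theorem T_zero_left (x : L₀) (a : L₁) : A.T 0 x a = 0 := by simp [T]

theorem T_zero_right (x : L₀) (a : L₁) : A.T x 0 a = 0 := by simp [T]

theorem T_neg (x y : L₀) (a : L₁) : A.T x y (-a) = -A.T x y a := by
  simp only [T, map_neg]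
  module

theorem S_Om_swap (x y z w : L₀) : A.S y (A.Om x z w) = A.S w (A.Om x y z) := by
  rw [A.S_Om, A.Om_skew₂₃, map_neg, neg_neg]

/-- (E5) and (E3) move ∂ from a to Ω(x, y, z), and ∂Ω is minus the cyclic Jacobiator. -/
theorem S_Om_d (x y z : L₀) (a : L₁) : A.S z (A.Om x y (A.d a)) =
    A.S (A.br (A.br x y) z) a + A.S (A.br (A.br y z) x) a + A.S (A.br (A.br z x) y) a := by
  rw [A.S_Om, ← A.S_d, A.d_Om]
  simp only [map_neg, map_add, LinearMap.neg_apply, LinearMap.add_apply]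
  abel

/-- The component of the Jacobi identity on three elements of degree `0` and one of degree `-1`. -/
theorem jacobi_T (x y z : L₀) (a : L₁) :
    (1 / 2 : ℝ) • (A.rho x (A.T y z a) - A.rho y (A.T x z a) + A.rho z (A.T x y a))
      - A.T (A.br x y) z a + A.T (A.br x z) y a - A.T (A.br y z) x a
      - A.T y z (A.act x a) + A.T x z (A.act y a) - A.T x y (A.act z a)
      + A.S z (A.Om x y (A.d a)) = 0 := by
  rw [A.S_Om_d]
  simp only [T, A.S_act, A.rho_br, map_sub, map_smul, map_neg, LinearMap.neg_apply,
    A.br_skew x z, A.br_skew x (A.br _ _), A.br_skew y (A.br _ _), A.br_skew z (A.br _ _),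
    A.br_skew x y, A.br_skew y z]
  module

/-- `Ω̄` is closed. -/
theorem S_Om_closed (w x y z v : L₀) :
    A.rho w (A.S v (A.Om x y z)) - A.rho x (A.S v (A.Om w y z)) + A.rho y (A.S v (A.Om w x z))
      - A.rho z (A.S v (A.Om w x y)) + A.rho v (A.S z (A.Om w x y))
    = A.S v (A.Om (A.br w x) y z) - A.S v (A.Om (A.br w y) x z) + A.S v (A.Om (A.br w z) x y)
      - A.S z (A.Om (A.br w v) x y) + A.S v (A.Om (A.br x y) w z) - A.S v (A.Om (A.br x z) w y)
      + A.S z (A.Om (A.br x v) w y) + A.S v (A.Om (A.br y z) w x) - A.S z (A.Om (A.br y v) w x)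
      + A.S y (A.Om (A.br z v) w x) := by
  -- Closedness of Ω̄ is the ten-term identity for Ω paired with v; what follows brings every Ω̄
  -- into one normal form.
  have h := congrArg (A.S v) (A.act_Om w x y z)
  simp only [map_sub, map_add, A.S_D, A.S_act] at h
  rw [A.S_Om_cyc x y z (A.br w v), A.S_Om_cyc w y z (A.br x v), A.S_Om_cyc w x z (A.br y v),
    A.S_Om_cyc w x y (A.br z v), A.S_Om_cyc x y z w, A.Om_skew₁₂ (A.br w y) x,
    A.Om_skew₂₃ x (A.br w z) y, A.Om_skew₁₂ (A.br w z) x, A.Om_skew₁₂ (A.br x y) w,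
    A.Om_skew₂₃ w (A.br x z) y, A.Om_skew₁₂ (A.br x z) w,
    A.Om_skew₂₃ w (A.br y z) x, A.Om_skew₁₂ (A.br y z) w,
    A.S_Om w y z x, A.Om_skew₂₃ w x y, A.S_Om w x z y] at h
  simp only [map_neg, neg_neg] at h
  linear_combination (norm := module) h

end SkewCLWX

/-! ### The generalized Jacobi identities, arity by arity -/

namespace SkewCLWX

variable {L₂ L₁ L₀ : Type*} [AddCommGroup L₂] [Module ℝ L₂] [AddCommGroup L₁]
  [Module ℝ L₁] [AddCommGroup L₀] [Module ℝ L₀] (A : SkewCLWX L₂ L₁ L₀)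

/-- The left hand side of the `k`-th generalized Jacobi identity. -/
def jacobiSum (k : ℕ) (d : Fin k → ℤ) (x : Fin k → L₂ × L₁ × L₀) : L₂ × L₁ × L₀ :=
  ∑ i : Fin k, (-1 : ℤ) ^ ((i.val + 1) * (k - (i.val + 1))) •
    ∑ σ : Equiv.Perm (Fin k) with IsUnshuffle (i.val + 1) σ,
      ((Equiv.Perm.sign σ * koszulSign d σ : ℤˣ) : ℤ) •
        A.bracket (k - (i.val + 1) + 1) (Fin.cons
          (A.bracket (i.val + 1) (fun a => x (σ ⟨a.val, by omega⟩)))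
          (fun b : Fin (k - (i.val + 1)) => x (σ ⟨i.val + 1 + b.val, by omega⟩)))

theorem jacobiSum_mem (k : ℕ) (d : Fin k → ℤ) (x : Fin k → L₂ × L₁ × L₀)
    (hx : ∀ a, x a ∈ gradedPart L₂ L₁ L₀ (d a)) :
    A.jacobiSum k d x ∈ gradedPart L₂ L₁ L₀ (∑ a, d a + 3 - (k : ℤ)) := by
  refine Submodule.sum_mem _ fun i _ => zsmul_mem (Submodule.sum_mem _ fun σ _ => zsmul_mem ?_ _) _
  have hin := A.bracket_mem (i.val + 1) _ (fun a => x (σ ⟨a.val, by omega⟩)) (fun a => hx _)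
  have hout := A.bracket_mem (k - (i.val + 1) + 1)
    (Fin.cons _ fun b : Fin (k - (i.val + 1)) => d (σ ⟨i.val + 1 + b.val, by omega⟩))
    (Fin.cons _ (fun b : Fin (k - (i.val + 1)) => x (σ ⟨i.val + 1 + b.val, by omega⟩)))
    (Fin.cases hin fun b => hx _)
  convert hout using 1
  -- σ distributes the entries between the inner and the outer bracket, so the degrees add up to the
  -- total whatever σ is.
  have hsum : ∑ a, d a = ∑ a : Fin (i.val + 1), d (σ ⟨a.val, by omega⟩) +
      ∑ b : Fin (k - (i.val + 1)), d (σ ⟨i.val + 1 + b.val, by omega⟩) := by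
    have hk : i.val + 1 + (k - (i.val + 1)) = k := by omega
    rw [← Equiv.sum_comp σ, ← Equiv.sum_comp (finCongr hk), Fin.sum_univ_add]
    rfl
  rw [Fin.sum_univ_succ]
  simp only [Fin.cons_zero, Fin.cons_succ]
  rw [hsum]
  have hk : ((k - (i.val + 1) : ℕ) : ℤ) = (k : ℤ) - (i.val + 1) := by omega
  push_cast [hk]
  ring_nf

/-- The zero entry sits in the inner or in the outer bracket, and both are multilinear. This
disposes of degrees outside {-2, -1, 0}, whose graded part is zero. -/
theorem jacobiSum_eq_zero_of_apply_eq_zero {k : ℕ} (d : Fin k → ℤ) {x : Fin k → L₂ × L₁ × L₀}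
    {j : Fin k} (hj : x j = 0) : A.jacobiSum k d x = 0 := by
  refine Finset.sum_eq_zero fun i _ => ?_
  rw [Finset.sum_eq_zero, smul_zero]
  intro σ _
  suffices h : A.bracket (k - (i.val + 1) + 1) (Fin.cons
      (A.bracket (i.val + 1) (fun a => x (σ ⟨a.val, by omega⟩)))
      (fun b : Fin (k - (i.val + 1)) => x (σ ⟨i.val + 1 + b.val, by omega⟩))) = 0 by
    rw [h, smul_zero]
  by_cases hlt : (σ.symm j).val < i.val + 1
  · refine (A.bracket _).map_coord_zero 0 ?_
    refine (A.bracket _).map_coord_zero ⟨(σ.symm j).val, hlt⟩ ?_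
    simp [hj]
  · refine (A.bracket _).map_coord_zero
      (Fin.succ ⟨(σ.symm j).val - (i.val + 1), by omega⟩) ?_
    rw [Fin.cons_succ]
    have : (⟨i.val + 1 + ((σ.symm j).val - (i.val + 1)), by omega⟩ : Fin k) = σ.symm j := by
      ext; simp; omega
    simp [this, hj]

theorem jacobiSum_one (d : Fin 1 → ℤ) (x : Fin 1 → L₂ × L₁ × L₀) : A.jacobiSum 1 d x = 0 := by
  have h : ∀ X, A.b₁ (A.b₁ X) = 0 := fun X => by ext <;> simp [b₁, A.d_D]
  refine Finset.sum_eq_zero fun i _ => ?_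
  rw [Finset.sum_eq_zero, smul_zero]
  intro σ _
  obtain rfl : i = 0 := Subsingleton.elim _ _
  change _ • A.b₁ (A.b₁ (x (σ 0))) = 0
  rw [h, smul_zero]

/-- The terms containing 𝔩₅ vanish, and the Γ(E) component of the rest is a multiple of the
closedness of Ω̄. -/
theorem jacobiSum_five (d : Fin 5 → ℤ) (x : Fin 5 → L₂ × L₁ × L₀)
    (h : ∀ a b, a ≠ b → d a = 0 ∨ d b = 0) : A.jacobiSum 5 d x = 0 := by
  simp only [jacobiSum, koszulSign_eq_one h, mul_one]
  rw [Fin.sum_univ_five]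
  change (-1) ^ (1 * 4) • (∑ σ : Equiv.Perm (Fin 5) with IsUnshuffle 1 σ,
        ((Equiv.Perm.sign σ : ℤˣ) : ℤ) • (0 : L₂ × L₁ × L₀))
    + (-1) ^ (2 * 3) • (∑ σ : Equiv.Perm (Fin 5) with IsUnshuffle 2 σ,
        ((Equiv.Perm.sign σ : ℤˣ) : ℤ) •
          A.b₄ (A.b₂ (x (σ 0)) (x (σ 1))) (x (σ 2)) (x (σ 3)) (x (σ 4)))
    + (-1) ^ (3 * 2) • (∑ σ : Equiv.Perm (Fin 5) with IsUnshuffle 3 σ,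
        ((Equiv.Perm.sign σ : ℤˣ) : ℤ) •
          A.b₃ (A.b₃ (x (σ 0)) (x (σ 1)) (x (σ 2))) (x (σ 3)) (x (σ 4)))
    + (-1) ^ (4 * 1) • (∑ σ : Equiv.Perm (Fin 5) with IsUnshuffle 4 σ,
        ((Equiv.Perm.sign σ : ℤˣ) : ℤ) •
          A.b₂ (A.b₄ (x (σ 0)) (x (σ 1)) (x (σ 2)) (x (σ 3))) (x (σ 4)))
    + (-1) ^ (5 * 0) • (∑ σ : Equiv.Perm (Fin 5) with IsUnshuffle 5 σ,
        ((Equiv.Perm.sign σ : ℤˣ) : ℤ) • A.b₁ 0) = 0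
  rw [sum_unshuffle_five_two fun a b c e f => A.b₄ (A.b₂ (x a) (x b)) (x c) (x e) (x f),
    sum_unshuffle_five_three fun a b c e f => A.b₃ (A.b₃ (x a) (x b) (x c)) (x e) (x f),
    sum_unshuffle_five_four fun a b c e f => A.b₂ (A.b₄ (x a) (x b) (x c) (x e)) (x f)]
  have h₀ : A.b₁ 0 = 0 := by ext <;> simp [b₁]
  simp only [h₀, smul_zero, Finset.sum_const_zero]
  generalize x 0 = X₀, x 1 = X₁, x 2 = X₂, x 3 = X₃, x 4 = X₄
  have key := A.S_Om_closed X₀.2.2 X₁.2.2 X₂.2.2 X₃.2.2 X₄.2.2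
  ext
  · simp [b₂, b₃, b₄, T]
    generalize X₀.2.2 = w, X₁.2.2 = x, X₂.2.2 = y, X₃.2.2 = z, X₄.2.2 = v at *
    -- Each bracket is moved into the first slot of Ω, and each Ω̄ of four of the five elements is
    -- brought to a fixed order up to sign.
    simp only [A.S_Om_cyc _ _ _ (A.br _ _),
      A.S_Om_cyc x y z w, A.S_Om_swap w x y z, A.S_Om w x z y,
      A.S_Om_cyc x y v w, A.S_Om_swap w x y v, A.S_Om w x v y,
      A.S_Om_cyc x z v w, A.S_Om_swap w x z v, A.S_Om w x v z,
      A.S_Om_cyc y z v w, A.S_Om_swap w y z v, A.S_Om w y v z,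
      A.S_Om_cyc y z v x, A.S_Om_swap x y z v, A.S_Om x y v z]
    simp only [map_neg]
    -- A term ρ(v)Ω̄ occurs with weight ½ in 𝔩₂(𝔩₄) and four times with weight ¼, through T, in
    -- 𝔩₃(𝔩₃). A term with a bracket inside Ω̄ has weight 1 from 𝔩₄(𝔩₂) and ½ from T.
    linear_combination (norm := module) (-3 / 2 : ℝ) • key
  · simp [b₂, b₃, b₄]
  · simp [b₂, b₃, b₄]

/-- The Γ(E) component is `jacobi_T`, the Γ(K₋₁) component is `act_Om`, where 𝒟Ω̄ is the 𝔩₁(𝔩₄)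
term. -/
theorem jacobiSum_four (d : Fin 4 → ℤ) (x : Fin 4 → L₂ × L₁ × L₀) {i : Fin 4}
    (h : ∀ a, a ≠ i → d a = 0) (hx : ∀ a, x a ∈ gradedPart L₂ L₁ L₀ (d a)) :
    A.jacobiSum 4 d x = 0 := by
  have h' : ∀ a b, a ≠ b → d a = 0 ∨ d b = 0 := fun a b hab => by
    by_cases ha : a = i
    · exact Or.inr (h b (ha ▸ hab.symm))
    · exact Or.inl (h a ha)
  simp only [jacobiSum, koszulSign_eq_one h', mul_one]
  rw [Fin.sum_univ_four]
  change (-1) ^ (1 * 3) • (∑ σ : Equiv.Perm (Fin 4) with IsUnshuffle 1 σ,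
        ((Equiv.Perm.sign σ : ℤˣ) : ℤ) •
          A.b₄ (A.b₁ (x (σ 0))) (x (σ 1)) (x (σ 2)) (x (σ 3)))
    + (-1) ^ (2 * 2) • (∑ σ : Equiv.Perm (Fin 4) with IsUnshuffle 2 σ,
        ((Equiv.Perm.sign σ : ℤˣ) : ℤ) •
          A.b₃ (A.b₂ (x (σ 0)) (x (σ 1))) (x (σ 2)) (x (σ 3)))
    + (-1) ^ (3 * 1) • (∑ σ : Equiv.Perm (Fin 4) with IsUnshuffle 3 σ,
        ((Equiv.Perm.sign σ : ℤˣ) : ℤ) •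
          A.b₂ (A.b₃ (x (σ 0)) (x (σ 1)) (x (σ 2))) (x (σ 3)))
    + (-1) ^ (4 * 0) • (∑ σ : Equiv.Perm (Fin 4) with IsUnshuffle 4 σ,
        ((Equiv.Perm.sign σ : ℤˣ) : ℤ) •
          A.b₁ (A.b₄ (x (σ 0)) (x (σ 1)) (x (σ 2)) (x (σ 3)))) = 0
  rw [sum_unshuffle_four_one fun a b c e => A.b₄ (A.b₁ (x a)) (x b) (x c) (x e),
    sum_unshuffle_four_two fun a b c e => A.b₃ (A.b₂ (x a) (x b)) (x c) (x e),
    sum_unshuffle_four_three fun a b c e => A.b₂ (A.b₃ (x a) (x b) (x c)) (x e),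
    sum_unshuffle_four_four fun a b c e => A.b₁ (A.b₄ (x a) (x b) (x c) (x e))]
  have h₁ : ∀ a, a ≠ i → (x a).2.1 = 0 := fun a ha => (hx a).2.1 (by simp [h a ha])
  have h₂ : ∀ a, a ≠ i → (x a).1 = 0 := fun a ha => (hx a).1 (by simp [h a ha])
  have key₁ := A.act_Om (x 0).2.2 (x 1).2.2 (x 2).2.2 (x 3).2.2
  ext
  -- The position i of the exceptional entry only changes the overall sign, that of moving it to the
  -- last place.
  · obtain rfl | rfl | rfl | rfl : i = 0 ∨ i = 1 ∨ i = 2 ∨ i = 3 := by fin_cases i <;> simp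
    · simp [b₁, b₂, b₃, b₄, h₁, h₂, A.T_zero, A.T_neg,
        A.T_skew (A.br _ _), A.Om_rot _ _ (A.d _)]
      linear_combination (norm := module)
        (-1 : ℝ) • A.jacobi_T (x 1).2.2 (x 2).2.2 (x 3).2.2 (x 0).2.1
    · simp [b₁, b₂, b₃, b₄, h₁, h₂, A.T_zero, A.T_neg,
        A.T_skew (A.br _ _), A.Om_rot _ _ (A.d _), A.T_skew (x 0).2.2 (x 2).2.2,
        A.T_skew (x 0).2.2 (x 3).2.2]
      linear_combination (norm := module)
        (1 : ℝ) • A.jacobi_T (x 0).2.2 (x 2).2.2 (x 3).2.2 (x 1).2.1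
    · simp [b₁, b₂, b₃, b₄, h₁, h₂, A.T_zero, A.T_neg,
        A.T_skew (A.br _ _), A.Om_rot _ _ (A.d _), A.T_skew (x 0).2.2 (x 3).2.2,
        A.T_skew (x 1).2.2 (x 3).2.2]
      linear_combination (norm := module)
        (-1 : ℝ) • A.jacobi_T (x 0).2.2 (x 1).2.2 (x 3).2.2 (x 2).2.1
    · simp [b₁, b₂, b₃, b₄, h₁, h₂, A.T_zero, A.Om_rot _ _ (A.d _)]
      linear_combination (norm := module)
        (1 : ℝ) • A.jacobi_T (x 0).2.2 (x 1).2.2 (x 2).2.2 (x 3).2.1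
  · simp [b₁, b₂, b₃, b₄]
    generalize (x 0).2.2 = w, (x 1).2.2 = x, (x 2).2.2 = y, (x 3).2.2 = z at *
    rw [A.Om_skew₁₂ (A.br w y) x, ← A.Om_rot x y (A.br w z), A.Om_skew₁₂ (A.br x y) w,
      ← A.Om_rot w y (A.br x z), ← A.Om_rot w x (A.br y z)] at key₁
    linear_combination (norm := module) (-1 : ℝ) • key₁
  · simp [b₁, b₂, b₃, b₄]

theorem jacobiSum_two (d : Fin 2 → ℤ) (x : Fin 2 → L₂ × L₁ × L₀)
    (hx : ∀ a, x a ∈ gradedPart L₂ L₁ L₀ (d a)) : A.jacobiSum 2 d x = 0 := by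
  rw [jacobiSum, Fin.sum_univ_two]
  change (-1) ^ (1 * 1) • (∑ σ : Equiv.Perm (Fin 2) with IsUnshuffle 1 σ,
        ((Equiv.Perm.sign σ * koszulSign d σ : ℤˣ) : ℤ) • A.b₂ (A.b₁ (x (σ 0))) (x (σ 1)))
    + (-1) ^ (2 * 0) • (∑ σ : Equiv.Perm (Fin 2) with IsUnshuffle 2 σ,
        ((Equiv.Perm.sign σ * koszulSign d σ : ℤˣ) : ℤ) • A.b₁ (A.b₂ (x (σ 0)) (x (σ 1)))) = 0
  rw [sum_unshuffle_two_one_koszul d fun a b => A.b₂ (A.b₁ (x a)) (x b),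
    sum_unshuffle_two_two_koszul d fun a b => A.b₁ (A.b₂ (x a) (x b))]
  have h0 := mem_gradedPart.1 (hx 0)
  have h1 := mem_gradedPart.1 (hx 1)
  generalize x 0 = X, x 1 = Y, d 0 = m, d 1 = n at *
  by_cases hm : m = 0
  · subst hm
    simp only [ne_eq, Int.reduceEq, Int.reduceNeg, not_false_eq_true, forall_const, zero_eq_neg,
      OfNat.ofNat_ne_zero] at h0
    ext <;> simp [b₁, b₂, A.rho_d, A.act_D, A.d_act, h0, A.br_skew (A.d _)]
  by_cases hn : n = 0
  · subst hn
    simp only [ne_eq, Int.reduceEq, Int.reduceNeg, not_false_eq_true, forall_const, zero_eq_neg,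
      OfNat.ofNat_ne_zero] at h1
    ext <;> simp [b₁, b₂, A.rho_d, A.act_D, A.d_act, h1, A.br_skew (A.d _)]
  -- Both degrees are now nonzero. Two entries of degree -1 give the skewness `act_d`; in all other
  -- cases every term vanishes, using ρ∘∂ = 0.
  by_cases hmn : m = -1 ∧ n = -1
  · obtain ⟨rfl, rfl⟩ := hmn
    ext <;> simp [b₁, b₂, A.rho_d, h0.2.2 hm, h1.2.2 hn, A.act_d X.2.1]
  · have : X.2.1 = 0 ∨ Y.2.1 = 0 := by
      by_cases hm' : m = -1
      · exact Or.inr (h1.2.1 fun hn' => hmn ⟨hm', hn'⟩)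
      · exact Or.inl (h0.2.1 hm')
    rcases this with h | h <;> ext <;> simp [b₁, b₂, A.rho_d, h0.2.2 hm, h1.2.2 hn, h]

/-- The total degree is -2, and in Γ(E) only 𝔩₃(𝔩₁) contributes; its Koszul signs make T(∂a, x, b)
and T(∂b, x, a) enter with the same sign, so `T_d_symm` applies. -/
theorem jacobiSum_three_of_two (d : Fin 3 → ℤ) (x : Fin 3 → L₂ × L₁ × L₀) {i : Fin 3}
    (hi : d i = 0) (h : ∀ a, a ≠ i → d a = -1) (hx : ∀ a, x a ∈ gradedPart L₂ L₁ L₀ (d a)) :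
    A.jacobiSum 3 d x = 0 := by
  have hmem := A.jacobiSum_mem 3 d x hx
  have hsum : ∑ a, d a = -2 := by
    rw [← Finset.add_sum_erase _ _ (Finset.mem_univ i), hi,
      Finset.sum_congr rfl fun a ha => h a (Finset.ne_of_mem_erase ha)]
    simp
  rw [hsum, mem_gradedPart] at hmem
  refine Prod.ext ?_ (Prod.ext (hmem.2.1 (by norm_num)) (hmem.2.2 (by norm_num)))
  have hx2 : ∀ a, (x a).1 = 0 := fun a => (hx a).1 (by
    by_cases ha : a = i
    · simp [ha, hi]
    · simp [h a ha])
  rw [jacobiSum, Fin.sum_univ_three]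
  change ((-1 : ℤ) ^ (1 * 2) • (∑ σ : Equiv.Perm (Fin 3) with IsUnshuffle 1 σ,
        ((Equiv.Perm.sign σ * koszulSign d σ : ℤˣ) : ℤ) •
          A.b₃ (A.b₁ (x (σ 0))) (x (σ 1)) (x (σ 2)))
    + (-1 : ℤ) ^ (2 * 1) • (∑ σ : Equiv.Perm (Fin 3) with IsUnshuffle 2 σ,
        ((Equiv.Perm.sign σ * koszulSign d σ : ℤˣ) : ℤ) •
          A.b₂ (A.b₂ (x (σ 0)) (x (σ 1))) (x (σ 2)))
    + (-1 : ℤ) ^ (3 * 0) • (∑ σ : Equiv.Perm (Fin 3) with IsUnshuffle 3 σ,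
        ((Equiv.Perm.sign σ * koszulSign d σ : ℤˣ) : ℤ) •
          A.b₁ (A.b₃ (x (σ 0)) (x (σ 1)) (x (σ 2))))).1 = 0
  rw [sum_unshuffle_three_one_koszul d fun a b c => A.b₃ (A.b₁ (x a)) (x b) (x c)]
  have h₁ : ∀ a b c, (A.b₂ (A.b₂ (x a) (x b)) (x c)).1 = 0 := fun a b c => by simp [b₂, hx2]
  have h₂ : ∀ X : L₂ × L₁ × L₀, (A.b₁ X).1 = 0 := fun X => rfl
  simp only [Prod.fst_add, Prod.smul_fst, Prod.fst_sum, h₁, h₂, smul_zero, Finset.sum_const_zero,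
    add_zero]
  have hx0 : ∀ a, a ≠ i → (x a).2.2 = 0 := fun a ha => (hx a).2.2 (by simp [h a ha])
  have hx1 : (x i).2.1 = 0 := (hx i).2.1 (by simp [hi])
  obtain rfl | rfl | rfl : i = 0 ∨ i = 1 ∨ i = 2 := by fin_cases i <;> simp
  · simp [b₁, b₃, hi, h, hx0, hx1, hx2, A.T_zero, A.T_zero_left]
    linear_combination (norm := module) A.T_d_symm (x 0).2.2 (x 1).2.1 (x 2).2.1
  · simp [b₁, b₃, hi, h, hx0, hx1, hx2, A.T_zero, A.T_zero_left,
      A.T_skew (A.d _)]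
    linear_combination (norm := module) (-1 : ℝ) • A.T_d_symm (x 1).2.2 (x 0).2.1 (x 2).2.1
  · simp [b₁, b₃, hi, h, hx0, hx1, hx2, A.T_zero, A.T_zero_left,
      A.T_skew (A.d _)]
    linear_combination (norm := module) A.T_d_symm (x 2).2.2 (x 0).2.1 (x 1).2.1

/-- The components in Γ(K₀), Γ(K₋₁) and Γ(E) come from `d_Om`, `Om_d` and `T_D` respectively. -/
theorem jacobiSum_three_of_one (d : Fin 3 → ℤ) (x : Fin 3 → L₂ × L₁ × L₀) {i : Fin 3}
    (h : ∀ a, a ≠ i → d a = 0) (hx : ∀ a, x a ∈ gradedPart L₂ L₁ L₀ (d a)) :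
    A.jacobiSum 3 d x = 0 := by
  have h' : ∀ a b, a ≠ b → d a = 0 ∨ d b = 0 := fun a b hab => by
    by_cases ha : a = i
    · exact Or.inr (h b (ha ▸ hab.symm))
    · exact Or.inl (h a ha)
  simp only [jacobiSum, koszulSign_eq_one h', mul_one]
  rw [Fin.sum_univ_three]
  change (-1 : ℤ) ^ (1 * 2) • (∑ σ : Equiv.Perm (Fin 3) with IsUnshuffle 1 σ,
        ((Equiv.Perm.sign σ : ℤˣ) : ℤ) • A.b₃ (A.b₁ (x (σ 0))) (x (σ 1)) (x (σ 2)))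
    + (-1 : ℤ) ^ (2 * 1) • (∑ σ : Equiv.Perm (Fin 3) with IsUnshuffle 2 σ,
        ((Equiv.Perm.sign σ : ℤˣ) : ℤ) • A.b₂ (A.b₂ (x (σ 0)) (x (σ 1))) (x (σ 2)))
    + (-1 : ℤ) ^ (3 * 0) • (∑ σ : Equiv.Perm (Fin 3) with IsUnshuffle 3 σ,
        ((Equiv.Perm.sign σ : ℤˣ) : ℤ) • A.b₁ (A.b₃ (x (σ 0)) (x (σ 1)) (x (σ 2)))) = 0
  rw [sum_unshuffle_three_one fun a b c => A.b₃ (A.b₁ (x a)) (x b) (x c),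
    sum_unshuffle_three_two fun a b c => A.b₂ (A.b₂ (x a) (x b)) (x c),
    sum_unshuffle_three_three fun a b c => A.b₁ (A.b₃ (x a) (x b) (x c))]
  have h₁ : ∀ a, a ≠ i → (x a).2.1 = 0 := fun a ha => (hx a).2.1 (by simp [h a ha])
  have h₂ : ∀ a, a ≠ i → (x a).1 = 0 := fun a ha => (hx a).1 (by simp [h a ha])
  obtain rfl | rfl | rfl : i = 0 ∨ i = 1 ∨ i = 2 := by fin_cases i <;> simp
  · ext <;> simp [b₁, b₂, b₃, h₁, h₂, A.T_D, A.T_zero, A.T_zero_right, A.rho_br,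
      A.d_Om, A.Om_d_eq, A.Om_rot _ _ (A.d _), A.br_skew (x 0).2.2 (x 2).2.2] <;> module
  · ext <;> simp [b₁, b₂, b₃, h₁, h₂, A.T_D, A.T_zero, A.T_zero_left, A.T_zero_right, A.rho_br,
      A.d_Om, A.Om_d_eq, A.Om_rot _ _ (A.d _), A.br_skew (x 0).2.2 (x 2).2.2,
      A.T_skew (x 0).2.2 (x 2).2.2] <;> module
  · ext <;> simp [b₁, b₂, b₃, h₁, h₂, A.T_D, A.T_zero, A.T_zero_left, A.rho_br,
      A.d_Om, A.Om_d_eq, A.Om_rot _ _ (A.d _), A.br_skew (x 0).2.2 (x 2).2.2] <;> module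

end SkewCLWX

/-! ### Assembly of the Lie 3-algebra -/

namespace SkewCLWX

variable {L₂ L₁ L₀ : Type*} [AddCommGroup L₂] [Module ℝ L₂] [AddCommGroup L₁]
  [Module ℝ L₁] [AddCommGroup L₀] [Module ℝ L₀] (A : SkewCLWX L₂ L₁ L₀)

theorem jacobiSum_eq_zero (k : ℕ) (d : Fin k → ℤ) (x : Fin k → L₂ × L₁ × L₀)
    (hx : ∀ a, x a ∈ gradedPart L₂ L₁ L₀ (d a)) : A.jacobiSum k d x = 0 := by
  by_cases hz : ∃ j, x j = 0
  · obtain ⟨j, hj⟩ := hz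
    exact A.jacobiSum_eq_zero_of_apply_eq_zero d hj
  push Not at hz
  have hd : ∀ a, -2 ≤ d a ∧ d a ≤ 0 := fun a => by
    by_contra hda
    exact hz a (eq_zero_of_mem_gradedPart (hx a) (by omega) (by omega) (by omega))
  have hmem := A.jacobiSum_mem k d x hx
  have hle : ∑ a, d a ≤ 0 := Finset.sum_nonpos fun a _ => (hd a).2
  -- Below degree -2 there is nothing to prove. Otherwise the entries' degrees sum to at least k -
  -- 5, which excludes k ≥ 6 and forces all degrees to be 0 when k = 5.
  by_cases hdeg : ∑ a, d a + 3 - (k : ℤ) < -2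
  · exact eq_zero_of_mem_gradedPart hmem (by omega) (by omega) (by omega)
  match k with
  | 0 => rfl
  | 1 => exact A.jacobiSum_one d x
  | 2 => exact A.jacobiSum_two d x hx
  | 3 =>
    rw [Fin.sum_univ_three] at hdeg
    have h₀ := hd 0
    have h₁ := hd 1
    have h₂ := hd 2
    have h : (∃ i, ∀ a, a ≠ i → d a = 0) ∨ ∃ i, d i = 0 ∧ ∀ a, a ≠ i → d a = -1 := by
      simp only [Fin.exists_fin_succ, Fin.forall_fin_succ]
      simp
      omega
    rcases h with ⟨i, h⟩ | ⟨i, hi, h⟩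
    · exact A.jacobiSum_three_of_one d x h hx
    · exact A.jacobiSum_three_of_two d x hi h hx
  | 4 =>
    rw [Fin.sum_univ_four] at hdeg
    have h₀ := hd 0
    have h₁ := hd 1
    have h₂ := hd 2
    have h₃ := hd 3
    have h : ∃ i, ∀ a, a ≠ i → d a = 0 := by
      simp only [Fin.exists_fin_succ, Fin.forall_fin_succ]
      simp
      omega
    obtain ⟨i, h⟩ := h
    exact A.jacobiSum_four d x h hx
  | 5 =>
    have h := (Finset.sum_eq_zero_iff_of_nonpos fun a _ => (hd a).2).1
      (by push_cast at hdeg; omega : ∑ a, d a = 0)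
    exact A.jacobiSum_five d x fun a _ _ => Or.inl (h a (Finset.mem_univ a))
  | k + 6 => push_cast at hdeg; omega

/-- The Lie 3-algebra of skew-symmetrised CLWX data. -/
def lieThreeAlgebra : LieThreeAlgebra L₂ L₁ L₀ where
  l k := (A.bracket k).toMultilinearMap
  degree := A.bracket_mem
  skew := A.bracket_perm
  jacobi := A.jacobiSum_eq_zero

theorem lieThreeAlgebra_l (k : ℕ) (v : Fin k → L₂ × L₁ × L₀) :
    A.lieThreeAlgebra.l k v = A.bracket k v := rfl

end SkewCLWX

/-! ### From an E-CLWX 2-algebroid to skew-symmetrised data -/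

/-- The curried form of an alternating map of three variables. -/
def curryThree {V W : Type*} [AddCommGroup V] [Module ℝ V] [AddCommGroup W] [Module ℝ W]
    (f : V [⋀^Fin 3]→ₗ[ℝ] W) : V →ₗ[ℝ] V →ₗ[ℝ] V →ₗ[ℝ] W :=
  have h₀ : ∀ x y z w : V, Function.update ![x, y, z] 0 w = ![w, y, z] := fun x y z w => by
    ext i; fin_cases i <;> rfl
  have h₁ : ∀ x y z w : V, Function.update ![x, y, z] 1 w = ![x, w, z] := fun x y z w => by
    ext i; fin_cases i <;> rfl
  have h₂ : ∀ x y z w : V, Function.update ![x, y, z] 2 w = ![x, y, w] := fun x y z w => by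
    ext i; fin_cases i <;> rfl
  LinearMap.mk₂ ℝ
    (fun x y =>
      { toFun z := f ![x, y, z]
        map_add' z w := by simpa only [h₂] using f.map_update_add ![x, y, 0] 2 z w
        map_smul' c z := by
          simpa only [h₂, RingHom.id_apply] using f.map_update_smul ![x, y, 0] 2 c z })
    (fun x x' y => LinearMap.ext fun z => by
      change f ![x + x', y, z] = f ![x, y, z] + f ![x', y, z]
      simpa only [h₀] using f.map_update_add ![0, y, z] 0 x x')
    (fun c x y => LinearMap.ext fun z => by
      change f ![c • x, y, z] = c • f ![x, y, z]
      simpa only [h₀] using f.map_update_smul ![0, y, z] 0 c x)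
    (fun x y y' => LinearMap.ext fun z => by
      change f ![x, y + y', z] = f ![x, y, z] + f ![x, y', z]
      simpa only [h₁] using f.map_update_add ![x, 0, z] 1 y y')
    (fun c x y => LinearMap.ext fun z => by
      change f ![x, c • y, z] = c • f ![x, y, z]
      simpa only [h₁] using f.map_update_smul ![x, 0, z] 1 c y)

@[simp]
theorem curryThree_apply {V W : Type*} [AddCommGroup V] [Module ℝ V] [AddCommGroup W] [Module ℝ W]
    (f : V [⋀^Fin 3]→ₗ[ℝ] W) (x y z : V) : curryThree f x y z = f ![x, y, z] := rfl

theorem map_vec_swap₁₂ {V W : Type*} [AddCommGroup V] [Module ℝ V] [AddCommGroup W]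
    [Module ℝ W] (f : V [⋀^Fin 3]→ₗ[ℝ] W) (x y z : V) : f ![y, x, z] = -f ![x, y, z] := by
  rw [← f.map_swap _ (show (0 : Fin 3) ≠ 1 by decide)]
  congr 1
  ext i; fin_cases i <;> rfl

theorem map_vec_swap₂₃ {V W : Type*} [AddCommGroup V] [Module ℝ V] [AddCommGroup W]
    [Module ℝ W] (f : V [⋀^Fin 3]→ₗ[ℝ] W) (x y z : V) : f ![x, z, y] = -f ![x, y, z] := by
  rw [← f.map_swap _ (show (1 : Fin 3) ≠ 2 by decide)]
  congr 1
  ext i; fin_cases i <;> rfl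

section Algebroid

variable {EM : Type*} [NormedAddCommGroup EM] [NormedSpace ℝ EM]
  {H : Type*} [TopologicalSpace H] {I : ModelWithCorners ℝ EM H}
  {M : Type*} [TopologicalSpace M] [ChartedSpace H M]
  {F : Type*} [NormedAddCommGroup F] [NormedSpace ℝ F]
  {E : M → Type*} [TopologicalSpace (TotalSpace F E)] [∀ m, AddCommGroup (E m)]
  [∀ m, Module ℝ (E m)] [∀ m, TopologicalSpace (E m)] [FiberBundle F E] [VectorBundle ℝ F E]
  {F₁ : Type*} [NormedAddCommGroup F₁] [NormedSpace ℝ F₁]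
  {K₁ : M → Type*} [TopologicalSpace (TotalSpace F₁ K₁)] [∀ m, AddCommGroup (K₁ m)]
  [∀ m, Module ℝ (K₁ m)] [∀ m, TopologicalSpace (K₁ m)] [FiberBundle F₁ K₁] [VectorBundle ℝ F₁ K₁]
  {F₀ : Type*} [NormedAddCommGroup F₀] [NormedSpace ℝ F₀]
  {K₀ : M → Type*} [TopologicalSpace (TotalSpace F₀ K₀)] [∀ m, AddCommGroup (K₀ m)]
  [∀ m, Module ℝ (K₀ m)] [∀ m, TopologicalSpace (K₀ m)] [FiberBundle F₀ K₀] [VectorBundle ℝ F₀ K₀]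

namespace ECLWXTwoAlgebroid

variable (A : ECLWXTwoAlgebroid I F E F₁ K₁ F₀ K₀)

/-- The Courant bracket `⟦e⁰, e¹⟧` as a bilinear map. -/
def actLin : Sec I F₀ K₀ →ₗ[ℝ] Sec I F₁ K₁ →ₗ[ℝ] Sec I F₁ K₁ :=
  (1 / 2 : ℝ) • (A.dia₀₁ - A.dia₁₀.flip)

theorem actLin_apply (x : Sec I F₀ K₀) (a : Sec I F₁ K₁) : A.actLin x a = A.courant₀₁ x a := rfl

theorem dia₁₀_eq (x : Sec I F₀ K₀) (a : Sec I F₁ K₁) :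
    A.dia₁₀ a x = A.DLin (A.S x a) - A.dia₀₁ x a := by
  rw [A.DLin_apply, ← A.dia_symm, add_sub_cancel_left]

/-- The splitting of `⋄` into its skew part and the symmetric part prescribed by (E2). -/
theorem dia₀₁_eq (x : Sec I F₀ K₀) (a : Sec I F₁ K₁) :
    A.dia₀₁ x a = A.actLin x a + (1 / 2 : ℝ) • A.DLin (A.S x a) := by
  rw [actLin_apply, PreECLWX.courant₀₁, dia₁₀_eq]
  module

theorem D_zero : A.D 0 = 0 := A.DLin.map_zero

theorem courant₀₀_eq (x y : Sec I F₀ K₀) : A.courant₀₀ x y = A.dia₀₀ x y := by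
  rw [PreECLWX.courant₀₀, A.dia_skew x y]
  module

theorem courant₁₀_eq (x : Sec I F₀ K₀) (a : Sec I F₁ K₁) : A.courant₁₀ a x = -A.actLin x a := by
  rw [actLin_apply, PreECLWX.courant₁₀, PreECLWX.courant₀₁]
  module

/-- This is (E4) after that splitting; the last term is S(y, ½ 𝒟S(x, a)). -/
theorem S_actLin (x y : Sec I F₀ K₀) (a : Sec I F₁ K₁) :
    A.S y (A.actLin x a) =
      A.rho x (A.S y a) - A.S (A.dia₀₀ x y) a - (1 / 2 : ℝ) • A.rho y (A.S x a) := by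
  have h := A.rho_S x y a
  rw [dia₀₁_eq, map_add, map_smul, A.DLin_apply, A.S_D] at h
  rw [h]
  module

variable [FiniteDimensional ℝ EM] [IsManifold I ∞ M] [T2Space M] [FiniteDimensional ℝ F₀]
  [ContMDiffVectorBundle ∞ F₀ K₀ I]

/-- x ⋄ 𝒟u is 𝒟ρ(x)u, and its symmetric part is half of that. -/
theorem actLin_D (x : Sec I F₀ K₀) (u : Sec I F E) :
    A.actLin x (A.DLin u) = (1 / 2 : ℝ) • A.DLin (A.rho x u) := by
  have h := A.dia₀₁_eq x (A.D u)
  rw [A.dia_D, A.S_D] at h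
  simp only [PreECLWX.DLin_apply] at h ⊢
  linear_combination (norm := module) (-1 : ℝ) • h

variable [FiniteDimensional ℝ F] [ContMDiffVectorBundle ∞ F E I]
  [FiniteDimensional ℝ F₁] [ContMDiffVectorBundle ∞ F₁ K₁ I]

/-- The skew-symmetrised algebraic data of an `E`-CLWX 2-algebroid. -/
def skewCLWX : SkewCLWX (Sec I F E) (Sec I F₁ K₁) (Sec I F₀ K₀) where
  d := A.bdSec
  D := A.DLin
  rho := A.rho
  S := A.S
  br := A.dia₀₀
  act := A.actLin
  Om := curryThree A.Omega
  br_self := A.dia_self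
  Om_self₁₂ x y := A.Omega.map_eq_zero_of_eq ![x, x, y] (i := 0) (j := 1) rfl (by decide)
  Om_self₂₃ x y := A.Omega.map_eq_zero_of_eq ![x, y, y] (i := 1) (j := 2) rfl (by decide)
  S_Om := A.S_Omega
  d_act x a := by
    rw [actLin_apply, PreECLWX.courant₀₁, map_smul, map_sub, A.leibniz.d_right, A.leibniz.d_left,
      A.dia_skew x]
    module
  act_d a b := by
    simp only [actLin_apply, PreECLWX.courant₀₁]
    rw [A.leibniz.d_mid, ← A.leibniz.d_mid b a]
    module
  d_D := A.bd_D
  rho_d := A.rho_bd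
  S_D := A.S_D
  S_d := A.S_bd
  act_D := A.actLin_D
  rho_br := A.rho_dia
  S_act := A.S_actLin
  d_Om x y z := by
    have h := A.leibniz.leibniz₀₀₀ x y z
    rw [A.dia_skew (A.dia₀₀ y z) x, A.dia_skew z x, map_neg, A.dia_skew (A.dia₀₀ z x) y] at h
    refine h.trans ?_
    module
  Om_d x y a := by
    -- Once `⋄` is split, all corrections are 𝒟-exact and collect to 𝒟T(x, y, a).
    refine (A.leibniz.leibniz₀₀₁ x y a).trans ?_
    simp only [dia₀₁_eq, map_add, map_sub, map_smul, S_actLin, PreECLWX.DLin_apply,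
      A.S_D, A.dia_skew x y, map_neg, LinearMap.neg_apply]
    simp only [← PreECLWX.DLin_apply, actLin_D]
    module
  act_Om w x y z := by
    have h := A.leibniz.jacobiator w x y z
    simp only [AlternatingMap.coe_multilinearMap, dia₁₀_eq, dia₀₁_eq] at h
    -- By (E5) the correction terms are all multiples of 𝒟S(z, Ω(w, x, y)): three times -½ from the
    -- left actions and 1 - ½ from the right action, in total -1.
    rw [A.S_Omega x y z w, A.S_Omega w y z x, A.S_Omega w x z y, map_vec_swap₂₃ A.Omega x w y,
      map_vec_swap₁₂ A.Omega w x y, map_vec_swap₂₃ A.Omega w x y] at h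
    simp only [map_neg, neg_neg] at h
    simp only [curryThree_apply]
    linear_combination (norm := module) h

/-- Rewriting ⟦y, a⟧ and ⟦a, x⟧ under S turns the cyclic sum into 3 S(⟦x, y⟧, a) - (3/2)(ρ(x)S(y, a)
- ρ(y)S(x, a)), whence the weights ½ and ¼. -/
theorem T_eq (x y : Sec I F₀ K₀) (a : Sec I F₁ K₁) : A.skewCLWX.T x y a = A.T x y a := by
  rw [PreECLWX.T, ← actLin_apply, courant₀₀_eq, courant₁₀_eq, map_neg, S_actLin, S_actLin,
    A.dia_skew x y, map_neg, LinearMap.neg_apply]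
  simp only [SkewCLWX.T, skewCLWX]
  module

end ECLWXTwoAlgebroid

end Algebroid

end CLWX

end

/-! ### The main theorem -/

open CLWX
theorem mainTheorem4
    {EM : Type*} [NormedAddCommGroup EM] [NormedSpace ℝ EM] [FiniteDimensional ℝ EM]
    {H : Type*} [TopologicalSpace H] (I : ModelWithCorners ℝ EM H)
    {M : Type*} [TopologicalSpace M] [ChartedSpace H M] [IsManifold I ∞ M] [T2Space M]
    (F : Type*) [NormedAddCommGroup F] [NormedSpace ℝ F] [FiniteDimensional ℝ F]
    (E : M → Type*) [TopologicalSpace (TotalSpace F E)] [∀ m, AddCommGroup (E m)]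
    [∀ m, Module ℝ (E m)] [∀ m, TopologicalSpace (E m)] [FiberBundle F E] [VectorBundle ℝ F E]
    [ContMDiffVectorBundle ∞ F E I]
    (F₁ : Type*) [NormedAddCommGroup F₁] [NormedSpace ℝ F₁] [FiniteDimensional ℝ F₁]
    (K₁ : M → Type*) [TopologicalSpace (TotalSpace F₁ K₁)] [∀ m, AddCommGroup (K₁ m)]
    [∀ m, Module ℝ (K₁ m)] [∀ m, TopologicalSpace (K₁ m)] [FiberBundle F₁ K₁]
    [VectorBundle ℝ F₁ K₁] [ContMDiffVectorBundle ∞ F₁ K₁ I]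
    (F₀ : Type*) [NormedAddCommGroup F₀] [NormedSpace ℝ F₀] [FiniteDimensional ℝ F₀]
    (K₀ : M → Type*) [TopologicalSpace (TotalSpace F₀ K₀)] [∀ m, AddCommGroup (K₀ m)]
    [∀ m, Module ℝ (K₀ m)] [∀ m, TopologicalSpace (K₀ m)] [FiberBundle F₀ K₀]
    [VectorBundle ℝ F₀ K₀] [ContMDiffVectorBundle ∞ F₀ K₀ I]
    (A : ECLWXTwoAlgebroid I F E F₁ K₁ F₀ K₀) :
    ∃ L : LieThreeAlgebra (Sec I F E) (Sec I F₁ K₁) (Sec I F₀ K₀),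
      (∀ u : Sec I F E, L.l 1 ![deg2 u] = deg1 (A.D u)) ∧
      (∀ a : Sec I F₁ K₁, L.l 1 ![deg1 a] = deg0 (A.bdSec a)) ∧
      (∀ x y : Sec I F₀ K₀, L.l 2 ![deg0 x, deg0 y] = deg0 (A.courant₀₀ x y)) ∧
      (∀ (x : Sec I F₀ K₀) (a : Sec I F₁ K₁),
        L.l 2 ![deg0 x, deg1 a] = deg1 (A.courant₀₁ x a)) ∧
      (∀ (x : Sec I F₀ K₀) (f : Sec I F E),
        L.l 2 ![deg0 x, deg2 f] = deg2 ((1 / 2 : ℝ) • A.S x (A.D f))) ∧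
      (∀ a b : Sec I F₁ K₁, L.l 2 ![deg1 a, deg1 b] = 0) ∧
      (∀ x y z : Sec I F₀ K₀,
        L.l 3 ![deg0 x, deg0 y, deg0 z] = deg1 (A.Omega ![x, y, z])) ∧
      (∀ (x y : Sec I F₀ K₀) (a : Sec I F₁ K₁),
        L.l 3 ![deg0 x, deg0 y, deg1 a] = deg2 (- A.T x y a)) ∧
      (∀ x y z w : Sec I F₀ K₀,
        L.l 4 ![deg0 x, deg0 y, deg0 z, deg0 w] = deg2 (A.OmegaBar x y z w)) := by
  refine ⟨A.skewCLWX.lieThreeAlgebra, fun u => ?_, fun a => ?_, fun x y => ?_, fun x a => ?_,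
    fun x f => ?_, fun a b => ?_, fun x y z => ?_, fun x y a => ?_, fun x y z w => ?_⟩
  · simp [SkewCLWX.lieThreeAlgebra_l, SkewCLWX.bracket_one, SkewCLWX.b₁, deg1, deg2,
      ECLWXTwoAlgebroid.skewCLWX]
  · simp [SkewCLWX.lieThreeAlgebra_l, SkewCLWX.bracket_one, SkewCLWX.b₁, deg1, deg0,
      A.D_zero, ECLWXTwoAlgebroid.skewCLWX]
  · simp [SkewCLWX.lieThreeAlgebra_l, SkewCLWX.bracket_two, SkewCLWX.b₂, deg0,
      A.courant₀₀_eq, ECLWXTwoAlgebroid.skewCLWX]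
  · simp [SkewCLWX.lieThreeAlgebra_l, SkewCLWX.bracket_two, SkewCLWX.b₂, deg0, deg1,
      ← A.actLin_apply, ECLWXTwoAlgebroid.skewCLWX]
  · simp [SkewCLWX.lieThreeAlgebra_l, SkewCLWX.bracket_two, SkewCLWX.b₂, deg0, deg2, A.S_D,
      ECLWXTwoAlgebroid.skewCLWX]
  · simp [SkewCLWX.lieThreeAlgebra_l, SkewCLWX.bracket_two, SkewCLWX.b₂, deg1]
  · simp [SkewCLWX.lieThreeAlgebra_l, SkewCLWX.bracket_three, SkewCLWX.b₃, deg0, deg1,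
      SkewCLWX.T_zero, ECLWXTwoAlgebroid.skewCLWX]
  · simp [SkewCLWX.lieThreeAlgebra_l, SkewCLWX.bracket_three, SkewCLWX.b₃, deg0, deg1, deg2,
      SkewCLWX.T_zero_left, SkewCLWX.T_zero_right, ← A.T_eq]
  · simp [SkewCLWX.lieThreeAlgebra_l, SkewCLWX.bracket_four, SkewCLWX.b₄, deg0, deg2,
      PreECLWX.OmegaBar, ECLWXTwoAlgebroid.skewCLWX]
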